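/- A signature $\sigma=\mathrm{Rels}\uplus\mathrm{Cons}$ consists of finitely many (at least one) relation symbols of positive arity and finitely many constant symbols; $\mathrm{wd}(\sigma)$ is the maximal arity. A $\sigma$-structure has a non-empty domain $A\uplus\mathrm{Cons}$, where $A$ is its unnamed domain, and every constant is interpreted by itself. A $k$-type over $\sigma$ is a maximal consistent set of non-equality literals over the variables $x_1,\dots,x_k$ and the constants; $\boldsymbol\tau^{\sigma}_k$ is the set of all of them. Every tuple $\bar a$ of $k$ distinct unnamed elements of a structure $\mathfrak A$ realises exactly one $k$-type $\mathrm{tp}^{\mathfrak A}[\bar a]$. A $k$-type is guarded if $k\le 1$ or it contains a positive literal mentioning all of $x_1,\dots,x_k$. A sentence is in normal form (of the guarded fragment) if it is a finite conjunction of sentences of the forms $\exists\bar x(\alpha(\bar x)\wedge\psi(\bar x))$, $\forall\bar x(\alpha(\bar x)\to\psi(\bar x))$ and $\forall\bar x(\alpha(\bar x)\to\exists\bar y(\beta(\bar x,\bar y)\wedge\psi(\bar x,\bar y)))$, where the $\psi$ are quantifier-free, $\alpha$ and $\beta$ are atoms (relational or equalities), $\mathrm{fv}(\alpha)=\bar x$,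 and in the last form $\mathrm{fv}(\psi)\cup\bar y\subseteq\mathrm{fv}(\beta)\subseteq\bar x\cup\bar y$. A satisfiability witness for such a sentence $\varphi$ over $\sigma$ is a family $\boldsymbol\tau^*=\bigcup_{k=0}^{\mathrm{wd}(\sigma)}\boldsymbol\tau^*_k$ of non-empty sets $\boldsymbol\tau^*_k\subseteq\boldsymbol\tau^{\sigma}_k$ such that (1) for every type in $\boldsymbol\tau^*$, the types it induces on all tuples of distinct variables of it belong to $\boldsymbol\tau^*$; (2) $\boldsymbol\tau^*_0$ has exactly one element; (3) a $\sigma$-structure $\mathfrak B$ is a model of $\varphi$ whenever (a) every guarded $k$-type realised in $\mathfrak B$, $k\le\mathrm{wd}(\sigma)$, is in $\boldsymbol\tau^*_k$, and (b) for all $k<\mathrm{wd}(\sigma)$ and all $\tau_1\in\boldsymbol\tau^*_k$, $\tau_2\in\boldsymbol\tau^*_{k+1}$ with $\tau_1\subseteq\tau_2$, every tuple $\bar a$ of $k$ distinct unnamed elements with $\mathrm{tp}^{\mathfrak B}[\bar a]=\tau_1$ has an unnamed element $b\notin\bar a$ with $\mathrm{tp}^{\mathfrak B}[\bar a,b]=\tau_2$.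 **Proposition.** There exist a deterministic algorithm and a constant $C>0$ such that the following holds. For every normal-form sentence $\varphi$ over a signature $\sigma$, given $\sigma$, a satisfiability witness $\boldsymbol\tau^*$ for $\varphi$ and a parameter $n\in\mathbb N$ satisfying $$n\;\ge\;C\cdot\bigl|\boldsymbol\tau^{\sigma}_{\mathrm{wd}(\sigma)}\bigr|^{2^{\mathrm{wd}(\sigma)}},$$ the algorithm constructs a structure $\mathfrak B$ with unnamed domain of size $n$ such that $\mathfrak B\models\varphi$. The algorithm runs in time polynomial in $n^{\mathrm{wd}(\sigma)}$ and the encoding size of $\boldsymbol\tau^*$ (the polynomial does not depend on $\sigma$, $\varphi$, $\boldsymbol\tau^*$ or $n$). -/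

import Mathlib

namespace GF

open FirstOrder FirstOrder.Language

/-- A finite signature `σ = Rels ⊎ Cons`: relation symbols `0, …, numRel - 1` of positive arity, at
least one of them, and constant symbols `0, …, numCons - 1`. -/
structure Signature where
  numRel : ℕ
  arity : Fin numRel → ℕ
  numCons : ℕ
  numRel_pos : 0 < numRel
  arity_pos : ∀ R, 0 < arity R

namespace Signature

variable (σ : Signature)

/-- The width: the maximal arity of a relation symbol. -/
def wd : ℕ := Finset.univ.sup σ.arity

/-- The first-order language of `σ`: constants, no other function symbols, and the relations. -/
def lang : FirstOrder.Language.{0, 0} where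
  Functions k := {_c : Fin σ.numCons // k = 0}
  Relations k := {R : Fin σ.numRel // σ.arity R = k}

/-- A `σ`-structure with unnamed domain `A`. Under the standard name assumption its domain is
`A ⊎ Cons` and every constant is interpreted by itself, so that only the relations are to be given
(by their characteristic functions). -/
abbrev Str (A : Type) : Type :=
  (R : Fin σ.numRel) → (Fin (σ.arity R) → A ⊕ Fin σ.numCons) → Bool

/-- A `k`-type: a maximal consistent set of non-equality literals over `x₁, …, x_k` and the
constants. Such a set contains exactly one of every atom and its negation, so it is the same as a
structure with domain `{x₁, …, x_k} ⊎ Cons`. -/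
abbrev KType (k : ℕ) : Type := σ.Str (Fin k)

variable {σ}

/-- The first-order structure on `A ⊎ Cons` that is given by `B`. -/
@[reducible] def Str.toStructure {A : Type} (B : σ.Str A) :
    σ.lang.Structure (A ⊕ Fin σ.numCons) where
  funMap f _ := Sum.inr f.1
  RelMap R v := B R.1 (v ∘ Fin.cast R.2) = true

/-- `B ⊨ φ`. -/
def Str.Models {A : Type} (B : σ.Str A) (φ : σ.lang.Sentence) : Prop :=
  letI := B.toStructure
  (A ⊕ Fin σ.numCons) ⊨ φ

/-- The `k`-type that the tuple `a` of unnamed elements realises in `B`. Since types are structures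
themselves, this also gives the type that `τ` induces on a tuple of its variables. -/
def Str.tp {A : Type} (B : σ.Str A) {k : ℕ} (a : Fin k → A) : σ.KType k :=
  fun R t => B R (Sum.map a id ∘ t)

/-- A `k`-type is guarded if `k ≤ 1` or it contains a positive literal that mentions all of
`x₁, …, x_k`. -/
def KType.Guarded {k : ℕ} (τ : σ.KType k) : Prop :=
  k ≤ 1 ∨ ∃ (R : Fin σ.numRel) (t : Fin (σ.arity R) → Fin k ⊕ Fin σ.numCons),
    τ R t = true ∧ ∀ i : Fin k, ∃ j, t j = Sum.inl i

end Signature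

variable {σ : Signature}

/-! ### Normal-form sentences of the guarded fragment -/

/-- `∃ x̄ (α(x̄) ∧ ψ(x̄))` with guard `α` and `ψ` quantifier-free. -/
def IsGuardedExistential (χ : σ.lang.Sentence) : Prop :=
  ∃ (m : ℕ) (α ψ : σ.lang.Formula (Fin m)),
    α.IsAtomic ∧ ψ.IsQF ∧ α.freeVarFinset = Finset.univ ∧
    χ = Formula.iExs (Fin m) (Formula.relabel Sum.inr (α ⊓ ψ))

/-- `∀ x̄ (α(x̄) → ψ(x̄))` with guard `α` and `ψ` quantifier-free. -/
def IsGuardedUniversal (χ : σ.lang.Sentence) : Prop :=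
  ∃ (m : ℕ) (α ψ : σ.lang.Formula (Fin m)),
    α.IsAtomic ∧ ψ.IsQF ∧ α.freeVarFinset = Finset.univ ∧
    χ = Formula.iAlls (Fin m) (Formula.relabel Sum.inr (α.imp ψ))

/-- `∀ x̄ (α(x̄) → ∃ ȳ (β(x̄, ȳ) ∧ ψ(x̄, ȳ)))` with guards `α`, `β` and `ψ` quantifier-free, where
`fv(α) = x̄` and `fv(ψ) ∪ ȳ ⊆ fv(β)`. -/
def IsGuardedSkolem (χ : σ.lang.Sentence) : Prop :=
  ∃ (m l : ℕ) (α : σ.lang.Formula (Fin m)) (β ψ : σ.lang.Formula (Fin m ⊕ Fin l)),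
    α.IsAtomic ∧ β.IsAtomic ∧ ψ.IsQF ∧ α.freeVarFinset = Finset.univ ∧
    (∀ y : Fin l, Sum.inr y ∈ β.freeVarFinset) ∧ ψ.freeVarFinset ⊆ β.freeVarFinset ∧
    χ = Formula.iAlls (Fin m)
      (Formula.relabel Sum.inr (α.imp (Formula.iExs (Fin l) (β ⊓ ψ))))

/-- A finite conjunction of guarded existential, universal and Skolem sentences. -/
inductive IsNormalForm : σ.lang.Sentence → Prop
  | top : IsNormalForm ⊤
  | existential {χ : σ.lang.Sentence} (h : IsGuardedExistential χ) : IsNormalForm χ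
  | universal {χ : σ.lang.Sentence} (h : IsGuardedUniversal χ) : IsNormalForm χ
  | skolem {χ : σ.lang.Sentence} (h : IsGuardedSkolem χ) : IsNormalForm χ
  | inf {χ₁ χ₂ : σ.lang.Sentence} (h₁ : IsNormalForm χ₁) (h₂ : IsNormalForm χ₂) :
      IsNormalForm (χ₁ ⊓ χ₂)

/-! ### Satisfiability witnesses

A family `τ` of sets of types is given by a finite set `τ k` of `k`-types for every `k`; only the
sets with `k ≤ wd(σ)` matter. -/

/-- Every guarded `k`-type, `k ≤ wd(σ)`, that is realised in `B` belongs to the family. -/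
def IsGuardedBy (τ : ∀ k, Finset (σ.KType k)) {A : Type} (B : σ.Str A) : Prop :=
  ∀ k ≤ σ.wd, ∀ a : Fin k → A, Function.Injective a → (B.tp a).Guarded → B.tp a ∈ τ k

/-- The extension property of `B` with respect to the family `τ`. -/
def HasExtensionProperty (τ : ∀ k, Finset (σ.KType k)) {A : Type} (B : σ.Str A) : Prop :=
  ∀ k < σ.wd, ∀ τ₁ ∈ τ k, ∀ τ₂ ∈ τ (k + 1),
    Signature.Str.tp τ₂ (Fin.castSucc : Fin k → Fin (k + 1)) = τ₁ →
    ∀ a : Fin k → A, Function.Injective a → B.tp a = τ₁ →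
      ∃ b : A, b ∉ Set.range a ∧ B.tp (Fin.snoc a b : Fin (k + 1) → A) = τ₂

/-- `τ` is a satisfiability witness for `φ`: a closed and consistent family of non-empty sets of
types such that every structure (with a non-empty domain) that is `τ`-guarded and has the
`τ`-extension property is a model of `φ`. -/
structure IsSatWitness (τ : ∀ k, Finset (σ.KType k)) (φ : σ.lang.Sentence) : Prop where
  closed : ∀ k ≤ σ.wd, ∀ t ∈ τ k, ∀ (l : ℕ) (f : Fin l → Fin k), Function.Injective f →
    Signature.Str.tp t f ∈ τ l
  consistent : ∃! t, t ∈ τ 0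
  nonempty : ∀ k ≤ σ.wd, (τ k).Nonempty
  models : ∀ (A : Type) (B : σ.Str A), Nonempty (A ⊕ Fin σ.numCons) →
    IsGuardedBy τ B → HasExtensionProperty τ B → B.Models φ

/-! ### Random access programs with a step count

Registers and arrays hold natural numbers. Reading a register or an array cell, an addition, a
(truncated) subtraction, an assignment and a test take one step each. Products, quotients and
remainders are charged at least what they cost when they are computed by repeated addition or
subtraction, so that a program running in time `t` is simulated by a Turing machine in time
polynomial in `t` and the length of the input. -/

/-- Expressions: numerals, registers, cells of arrays, arithmetic. -/
inductive Expr
  | const (v : ℕ)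
  | reg (x : ℕ)
  | cell (a : ℕ) (i : Expr)
  | add (e₁ e₂ : Expr)
  | sub (e₁ e₂ : Expr)
  | mul (e₁ e₂ : Expr)
  | div (e₁ e₂ : Expr)
  | mod (e₁ e₂ : Expr)

/-- Programs (deterministic); a test succeeds if the value of the expression is not `0`. -/
inductive Program
  | skip
  | assign (x : ℕ) (e : Expr)
  | store (a : ℕ) (i e : Expr)
  | seq (p q : Program)
  | ite (e : Expr) (p q : Program)
  | loop (e : Expr) (p : Program)

/-- The content of the registers and of the arrays. -/
structure Memory where
  reg : ℕ → ℕ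
  arr : ℕ → ℕ → ℕ

def Expr.eval (s : Memory) : Expr → ℕ
  | const v => v
  | reg x => s.reg x
  | cell a i => s.arr a (i.eval s)
  | add e₁ e₂ => e₁.eval s + e₂.eval s
  | sub e₁ e₂ => e₁.eval s - e₂.eval s
  | mul e₁ e₂ => e₁.eval s * e₂.eval s
  | div e₁ e₂ => e₁.eval s / e₂.eval s
  | mod e₁ e₂ => e₁.eval s % e₂.eval s

/-- The number of steps for the evaluation of an expression. -/
def Expr.cost (s : Memory) : Expr → ℕ
  | const _ => 1
  | reg _ => 1
  | cell _ i => i.cost s + 1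
  | add e₁ e₂ => e₁.cost s + e₂.cost s + 1
  | sub e₁ e₂ => e₁.cost s + e₂.cost s + 1
  | mul e₁ e₂ => e₁.cost s + e₂.cost s + (e₁.eval s + e₂.eval s + 1)
  | div e₁ e₂ => e₁.cost s + e₂.cost s + (e₁.eval s + e₂.eval s + 1)
  | mod e₁ e₂ => e₁.cost s + e₂.cost s + (e₁.eval s + e₂.eval s + 1)

def Memory.setReg (s : Memory) (x v : ℕ) : Memory :=
  { s with reg := Function.update s.reg x v }

def Memory.setCell (s : Memory) (a i v : ℕ) : Memory :=
  { s with arr := Function.update s.arr a (Function.update (s.arr a) i v) }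

/-- `Exec p s r t`: started in `s`, the program `p` halts in `r` after exactly `t` steps. -/
inductive Exec : Program → Memory → Memory → ℕ → Prop
  | skip (s : Memory) : Exec .skip s s 1
  | assign (s : Memory) (x : ℕ) (e : Expr) :
      Exec (.assign x e) s (s.setReg x (e.eval s)) (e.cost s + 1)
  | store (s : Memory) (a : ℕ) (i e : Expr) :
      Exec (.store a i e) s (s.setCell a (i.eval s) (e.eval s)) (i.cost s + e.cost s + 1)
  | seq {p q : Program} {s r u : Memory} {t₁ t₂ : ℕ} (h₁ : Exec p s r t₁) (h₂ : Exec q r u t₂) :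
      Exec (.seq p q) s u (t₁ + t₂)
  | iteTrue {e : Expr} {p q : Program} {s r : Memory} {t : ℕ} (he : e.eval s ≠ 0)
      (h : Exec p s r t) : Exec (.ite e p q) s r (e.cost s + 1 + t)
  | iteFalse {e : Expr} {p q : Program} {s r : Memory} {t : ℕ} (he : e.eval s = 0)
      (h : Exec q s r t) : Exec (.ite e p q) s r (e.cost s + 1 + t)
  | loopStop {e : Expr} {p : Program} {s : Memory} (he : e.eval s = 0) :
      Exec (.loop e p) s s (e.cost s + 1)
  | loopStep {e : Expr} {p : Program} {s r u : Memory} {t₁ t₂ : ℕ} (he : e.eval s ≠ 0)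
      (h₁ : Exec p s r t₁) (h₂ : Exec (.loop e p) r u t₂) :
      Exec (.loop e p) s u (e.cost s + 1 + t₁ + t₂)

/-- Programs are deterministic: the final memory and the running time are unique. -/
theorem Exec.deterministic {p : Program} {s r r₂ : Memory} {t t₂ : ℕ}
    (h : Exec p s r t) (h₂ : Exec p s r₂ t₂) : r = r₂ ∧ t = t₂ := by
  induction h generalizing r₂ t₂ with
  | skip => cases h₂; exact ⟨rfl, rfl⟩
  | assign => cases h₂; exact ⟨rfl, rfl⟩
  | store => cases h₂; exact ⟨rfl, rfl⟩
  | seq _ _ ih₁ ih₂ =>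
    cases h₂ with
    | seq g₁ g₂ =>
      obtain ⟨rfl, rfl⟩ := ih₁ g₁
      obtain ⟨rfl, rfl⟩ := ih₂ g₂
      exact ⟨rfl, rfl⟩
  | iteTrue he _ ih =>
    cases h₂ with
    | iteTrue _ g => obtain ⟨rfl, rfl⟩ := ih g; exact ⟨rfl, rfl⟩
    | iteFalse he₂ _ => exact absurd he₂ he
  | iteFalse he _ ih =>
    cases h₂ with
    | iteTrue he₂ _ => exact absurd he he₂
    | iteFalse _ g => obtain ⟨rfl, rfl⟩ := ih g; exact ⟨rfl, rfl⟩
  | loopStop he =>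
    cases h₂ with
    | loopStop _ => exact ⟨rfl, rfl⟩
    | loopStep he₂ _ _ => exact absurd he he₂
  | loopStep he _ _ ih₁ ih₂ =>
    cases h₂ with
    | loopStop he₂ => exact absurd he₂ he
    | loopStep _ g₁ g₂ =>
      obtain ⟨rfl, rfl⟩ := ih₁ g₁
      obtain ⟨rfl, rfl⟩ := ih₂ g₂
      exact ⟨rfl, rfl⟩

/-! ### Encodings -/

/-- A structure with unnamed domain `{0, …, k - 1}` as a list of bits: for each relation symbol in
turn, the truth values on all tuples. The constant `c` is numbered `k + c`, and the tuple
`(e₀, e₁, …)` stands at the position `∑ eᵢ (k + |Cons|) ^ i`. -/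
def encodeStr {k : ℕ} (B : σ.Str (Fin k)) : List ℕ :=
  (List.finRange σ.numRel).flatMap fun R =>
    List.ofFn fun j : Fin ((k + σ.numCons) ^ σ.arity R) =>
      (B R fun i => finSumFinEquiv.symm (finFunctionFinEquiv.symm j i)).toNat

/-- The numbers of listed `k`-types, for `k = 0, …, wd(σ)`. -/
def encodeCounts (L : ∀ k, List (σ.KType k)) : List ℕ :=
  (List.range (σ.wd + 1)).map fun k => (L k).length

/-- The listed `k`-types, for `k = 0, …, wd(σ)`, one after the other. -/
def encodeTypes (L : ∀ k, List (σ.KType k)) : List ℕ :=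
  (List.range (σ.wd + 1)).flatMap fun k => (L k).flatMap fun t => encodeStr t

/-- The length of the encoding of a family of sets of types. -/
def encodingSize (L : ∀ k, List (σ.KType k)) : ℕ :=
  (encodeCounts L).length + (encodeTypes L).length

/-- The array that holds the list `l`, followed by zeros. -/
def arrayOf (l : List ℕ) : ℕ → ℕ := fun i => l.getD i 0

/-- The initial memory. Registers `0, 1, 2` hold `n`, `|Rels|` and `|Cons|`; arrays `0, 1, 2` hold
the arities and the listed family of sets of types; everything else is `0`. -/
def inputMemory (σ : Signature) (L : ∀ k, List (σ.KType k)) (n : ℕ) : Memory where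
  reg := arrayOf [n, σ.numRel, σ.numCons]
  arr
    | 0 => arrayOf (List.ofFn σ.arity)
    | 1 => arrayOf (encodeCounts L)
    | 2 => arrayOf (encodeTypes L)
    | _ => fun _ => 0

end GF

namespace GF

/-! ### Polynomial time functions on a context -/

/-- The numerical data of an input, with a bound `N` on its size. -/
structure Inst where
  n : ℕ
  m : ℕ
  c : ℕ
  N : ℕ
  ar : ℕ → ℕ
  cnt : ℕ → ℕ
  typ : ℕ → ℕ
  n_le : n ≤ N
  m_le : m ≤ N
  c_le : c ≤ N
  ar_le : ∀ i, ar i ≤ N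
  cnt_le : ∀ i, cnt i ≤ N
  typ_le : ∀ i, typ i ≤ N
  pow_le : ∀ i, (n + c) ^ ar i ≤ N

/-- An input together with the current content of the output array. -/
structure State where
  inst : Inst
  out : ℕ → ℕ
  out_le : ∀ i, out i ≤ 1

/-- Contexts: a state and finitely many local variables, which are kept in registers. -/
class Ctx (α : Type) where
  Loc : Type
  Below : Loc → ℕ → Prop
  Rep : Loc → α → Memory → Prop
  size : α → ℕ
  state : α → State
  below_mono : ∀ {l D D'}, Below l D → D ≤ D' → Below l D'
  rep_congr : ∀ {l D γ} {s s' : Memory}, Below l D → (∀ x < D, s'.reg x = s.reg x) →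
    s'.arr = s.arr → Rep l γ s → Rep l γ s'
  rep_state : ∀ {l γ} {s : Memory}, Rep l γ s →
    s.reg 0 = (state γ).inst.n ∧ s.reg 1 = (state γ).inst.m ∧ s.reg 2 = (state γ).inst.c ∧
    s.arr 0 = (state γ).inst.ar ∧ s.arr 1 = (state γ).inst.cnt ∧ s.arr 2 = (state γ).inst.typ ∧
    s.arr 3 = (state γ).out
  size_state : ∀ γ, (state γ).inst.N ≤ size γ

instance : Ctx State where
  Loc := Unit
  Below _ D := 3 ≤ D
  Rep _ x s := s.reg 0 = x.inst.n ∧ s.reg 1 = x.inst.m ∧ s.reg 2 = x.inst.c ∧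
    s.arr 0 = x.inst.ar ∧ s.arr 1 = x.inst.cnt ∧ s.arr 2 = x.inst.typ ∧ s.arr 3 = x.out
  size x := x.inst.N
  state x := x
  below_mono h h' := le_trans h h'
  rep_congr := by
    intro l D γ s s' hD hr ha h
    rw [ha, hr 0 (by omega), hr 1 (by omega), hr 2 (by omega)]
    exact h
  rep_state h := h
  size_state _ := le_rfl

/-- Every bounded quantifier, sum or iteration adds one such variable. Its value counts towards the
size, so polynomial bounds in an extended context turn into bounds in the original one once the
variable is bounded. -/
instance {α : Type} [Ctx α] : Ctx (α × ℕ) where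
  Loc := Ctx.Loc α × ℕ
  Below l D := Ctx.Below l.1 D ∧ l.2 < D
  Rep l γ s := Ctx.Rep l.1 γ.1 s ∧ s.reg l.2 = γ.2
  size γ := Ctx.size γ.1 + γ.2
  state γ := Ctx.state γ.1
  below_mono h h' := ⟨Ctx.below_mono h.1 h', lt_of_lt_of_le h.2 h'⟩
  rep_congr := by
    intro l D γ s s' hD hr ha h
    exact ⟨Ctx.rep_congr hD.1 hr ha h.1, by rw [hr _ hD.2]; exact h.2⟩
  rep_state h := Ctx.rep_state h.1
  size_state γ := (Ctx.size_state γ.1).trans (Nat.le_add_right _ _)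

section
variable {α : Type} [Ctx α]

/-- The input of a context. -/
abbrev inst (γ : α) : Inst := (Ctx.state γ).inst

/-- Polynomially bounded functions. -/
def PolyBdd (f : α → ℕ) : Prop := ∃ C, ∀ γ, f γ ≤ (Ctx.size γ + 2) ^ C

theorem PolyBdd.mono {f g : α → ℕ} (hg : PolyBdd g) (h : ∀ γ, f γ ≤ g γ) : PolyBdd f :=
  let ⟨C, hC⟩ := hg
  ⟨C, fun γ => (h γ).trans (hC γ)⟩

theorem PolyBdd.const (c : ℕ) : PolyBdd (fun _ : α => c) :=
  ⟨c, fun γ => Nat.lt_two_pow_self.le.trans (Nat.pow_le_pow_left (by omega) c)⟩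

theorem PolyBdd.size : PolyBdd (fun γ : α => Ctx.size γ) :=
  ⟨1, fun γ => by simp⟩

theorem PolyBdd.add {f g : α → ℕ} (hf : PolyBdd f) (hg : PolyBdd g) :
    PolyBdd (fun γ => f γ + g γ) := by
  obtain ⟨C, hC⟩ := hf
  obtain ⟨C', hC'⟩ := hg
  refine ⟨C + C' + 1, fun γ => ?_⟩
  have h1 : (Ctx.size γ + 2) ^ C ≤ (Ctx.size γ + 2) ^ (C + C') :=
    Nat.pow_le_pow_right (by omega) (by omega)
  have h2 : (Ctx.size γ + 2) ^ C' ≤ (Ctx.size γ + 2) ^ (C + C') :=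
    Nat.pow_le_pow_right (by omega) (by omega)
  calc f γ + g γ ≤ (Ctx.size γ + 2) ^ (C + C') + (Ctx.size γ + 2) ^ (C + C') :=
        add_le_add ((hC γ).trans h1) ((hC' γ).trans h2)
    _ = (Ctx.size γ + 2) ^ (C + C') * 2 := by ring
    _ ≤ (Ctx.size γ + 2) ^ (C + C') * (Ctx.size γ + 2) := Nat.mul_le_mul_left _ (by omega)
    _ = (Ctx.size γ + 2) ^ (C + C' + 1) := by rw [pow_succ]

theorem PolyBdd.mul {f g : α → ℕ} (hf : PolyBdd f) (hg : PolyBdd g) :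
    PolyBdd (fun γ => f γ * g γ) := by
  obtain ⟨C, hC⟩ := hf
  obtain ⟨C', hC'⟩ := hg
  exact ⟨C + C', fun γ => by rw [pow_add]; exact Nat.mul_le_mul (hC γ) (hC' γ)⟩

theorem PolyBdd.pow {f : α → ℕ} (hf : PolyBdd f) (k : ℕ) : PolyBdd (fun γ => f γ ^ k) := by
  obtain ⟨C, hC⟩ := hf
  exact ⟨C * k, fun γ => by rw [pow_mul]; exact Nat.pow_le_pow_left (hC γ) k⟩

theorem PolyBdd.fst {f : α → ℕ} (hf : PolyBdd f) : PolyBdd (fun γ : α × ℕ => f γ.1) := by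
  obtain ⟨C, hC⟩ := hf
  exact ⟨C, fun γ => (hC γ.1).trans (Nat.pow_le_pow_left (by
    change Ctx.size γ.1 + 2 ≤ Ctx.size γ.1 + γ.2 + 2; omega) C)⟩

/-- `Runs l D p f T`: the program `p` computes `f` into register `D` in time `T`, for contexts
stored at `l`, and changes neither the registers below `D` nor the arrays. -/
def Runs (l : Ctx.Loc α) (D : ℕ) (p : Program) (f T : α → ℕ) : Prop :=
  ∀ γ s, Ctx.Rep l γ s → ∃ s' t, Exec p s s' t ∧ t ≤ T γ ∧ s'.reg D = f γ ∧
    (∀ x < D, s'.reg x = s.reg x) ∧ s'.arr = s.arr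

/-- Functions with polynomially bounded values that are computed in polynomial time. -/
def Comp (f : α → ℕ) : Prop :=
  PolyBdd f ∧ ∃ T : α → ℕ, PolyBdd T ∧ ∀ l D, Ctx.Below l D → ∃ p, Runs l D p f T

theorem Comp.bdd {f : α → ℕ} (hf : Comp f) : PolyBdd f := hf.1

/-- Weakening: the same program works, since it never looks at the register of the additional
variable. -/
theorem Comp.fst {f : α → ℕ} (hf : Comp f) : Comp (fun γ : α × ℕ => f γ.1) := by
  obtain ⟨hb, T, hT, h⟩ := hf
  refine ⟨hb.fst, _, hT.fst, fun l D hl => ?_⟩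
  obtain ⟨p, hp⟩ := h l.1 D hl.1
  exact ⟨p, fun γ s hs => hp γ.1 s hs.1⟩

theorem Memory.setReg_reg_self (s : Memory) (x v : ℕ) : (s.setReg x v).reg x = v := by
  simp [Memory.setReg]

theorem Memory.setReg_reg_of_ne (s : Memory) {x y : ℕ} (v : ℕ) (h : y ≠ x) :
    (s.setReg x v).reg y = s.reg y := by
  simp [Memory.setReg, h]

/-- Functions that are values of expressions in the registers of the program. -/
theorem Comp.of_expr {f T : α → ℕ} (hf : PolyBdd f) (hT : PolyBdd T)
    (h : ∀ l : Ctx.Loc α, ∃ e : Expr, ∀ γ s, Ctx.Rep l γ s → e.eval s = f γ ∧ e.cost s ≤ T γ) :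
    Comp f := by
  refine ⟨hf, fun γ => T γ + 1, hT.add (PolyBdd.const 1), fun l D _ => ?_⟩
  obtain ⟨e, he⟩ := h l
  refine ⟨.assign D e, fun γ s hs => ⟨_, _, Exec.assign s D e, ?_, ?_, ?_, rfl⟩⟩
  · exact Nat.add_le_add_right (he γ s hs).2 1
  · rw [Memory.setReg_reg_self, (he γ s hs).1]
  · exact fun x hx => Memory.setReg_reg_of_ne _ _ hx.ne

theorem Comp.const (c : ℕ) : Comp (fun _ : α => c) :=
  Comp.of_expr (PolyBdd.const c) (PolyBdd.const 1) fun _ => ⟨.const c, fun _ _ _ => ⟨rfl, le_rfl⟩⟩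

theorem Comp.snd : Comp (fun γ : α × ℕ => γ.2) :=
  Comp.of_expr ((PolyBdd.size (α := α × ℕ)).mono fun γ => Nat.le_add_left γ.2 _) (PolyBdd.const 1)
    fun l => ⟨.reg l.2, fun _ _ h => ⟨h.2, le_rfl⟩⟩

theorem PolyBdd.N : PolyBdd (fun γ : α => (inst γ).N) := PolyBdd.size.mono Ctx.size_state

theorem Comp.n : Comp (fun γ : α => (inst γ).n) :=
  Comp.of_expr (PolyBdd.N.mono fun γ => (inst γ).n_le) (PolyBdd.const 1)
    fun _ => ⟨.reg 0, fun _ _ h => ⟨(Ctx.rep_state h).1, le_rfl⟩⟩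

theorem Comp.m : Comp (fun γ : α => (inst γ).m) :=
  Comp.of_expr (PolyBdd.N.mono fun γ => (inst γ).m_le) (PolyBdd.const 1)
    fun _ => ⟨.reg 1, fun _ _ h => ⟨(Ctx.rep_state h).2.1, le_rfl⟩⟩

theorem Comp.c : Comp (fun γ : α => (inst γ).c) :=
  Comp.of_expr (PolyBdd.N.mono fun γ => (inst γ).c_le) (PolyBdd.const 1)
    fun _ => ⟨.reg 2, fun _ _ h => ⟨(Ctx.rep_state h).2.2.1, le_rfl⟩⟩

/-- Applying an operation to the value of a computed function. -/
theorem Comp.unary {f g T : α → ℕ} (hf : Comp f) (hg : PolyBdd g) (hT : PolyBdd T)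
    (h : ∀ D, ∃ e : Expr, ∀ (l : Ctx.Loc α) γ s, Ctx.Rep l γ s → s.reg D = f γ →
      e.eval s = g γ ∧ e.cost s ≤ T γ) : Comp g := by
  obtain ⟨_, Tf, hTf, hp⟩ := hf
  refine ⟨hg, fun γ => Tf γ + (T γ + 1), hTf.add (hT.add (PolyBdd.const 1)), fun l D hl => ?_⟩
  obtain ⟨p, hp⟩ := hp l D hl
  obtain ⟨e, he⟩ := h D
  refine ⟨.seq p (.assign D e), fun γ s hs => ?_⟩
  obtain ⟨s', t, hx, ht, hv, hr, ha⟩ := hp γ s hs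
  have he := he l γ s' (Ctx.rep_congr hl hr ha hs) hv
  refine ⟨_, _, hx.seq (.assign s' D e), by have := he.2; dsimp only; omega, ?_, ?_, ha⟩
  · rw [Memory.setReg_reg_self, he.1]
  · exact fun x hx => (Memory.setReg_reg_of_ne _ _ hx.ne).trans (hr x hx)

/-- Applying an operation to the values of two computed functions. -/
theorem Comp.binary {f₁ f₂ g T : α → ℕ} (h₁ : Comp f₁) (h₂ : Comp f₂) (hg : PolyBdd g)
    (hT : PolyBdd T) (op : Expr → Expr → Expr)
    (h : ∀ s x y γ, s.reg x = f₁ γ → s.reg y = f₂ γ → (op (.reg x) (.reg y)).eval s = g γ ∧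
      (op (.reg x) (.reg y)).cost s ≤ T γ) : Comp g := by
  obtain ⟨_, T₁, hT₁, hp⟩ := h₁
  obtain ⟨_, T₂, hT₂, hq⟩ := h₂
  refine ⟨hg, fun γ => T₁ γ + (T₂ γ + (T γ + 1)),
    hT₁.add (hT₂.add (hT.add (PolyBdd.const 1))), fun l D hl => ?_⟩
  obtain ⟨p, hp⟩ := hp l D hl
  obtain ⟨q, hq⟩ := hq l (D + 1) (Ctx.below_mono hl (Nat.le_succ D))
  refine ⟨.seq p (.seq q (.assign D (op (.reg D) (.reg (D + 1))))), fun γ s hs => ?_⟩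
  obtain ⟨s', t, hx, ht, hv, hr, ha⟩ := hp γ s hs
  obtain ⟨s₂, t₂, hx₂, ht₂, hv₂, hr₂, ha₂⟩ := hq γ s' (Ctx.rep_congr hl hr ha hs)
  have he := h s₂ D (D + 1) γ ((hr₂ D (Nat.lt_succ_self D)).trans hv) hv₂
  refine ⟨_, _, hx.seq (hx₂.seq (.assign s₂ D _)), by have := he.2; dsimp only; omega, ?_, ?_, ha₂.trans ha⟩
  · rw [Memory.setReg_reg_self, he.1]
  · exact fun x hx => (Memory.setReg_reg_of_ne _ _ hx.ne).trans
      ((hr₂ x (by omega)).trans (hr x hx))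

theorem Comp.add {f g : α → ℕ} (hf : Comp f) (hg : Comp g) : Comp (fun γ => f γ + g γ) :=
  Comp.binary hf hg (hf.bdd.add hg.bdd) (PolyBdd.const 3) .add fun s x y γ hx hy => by
    simp [Expr.eval, Expr.cost, hx, hy]

theorem Comp.sub {f g : α → ℕ} (hf : Comp f) (hg : Comp g) : Comp (fun γ => f γ - g γ) :=
  Comp.binary hf hg (hf.bdd.mono fun γ => Nat.sub_le _ _) (PolyBdd.const 3) .sub
    fun s x y γ hx hy => by simp [Expr.eval, Expr.cost, hx, hy]

theorem Comp.mul {f g : α → ℕ} (hf : Comp f) (hg : Comp g) : Comp (fun γ => f γ * g γ) :=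
  Comp.binary hf hg (hf.bdd.mul hg.bdd) ((hf.bdd.add hg.bdd).add (PolyBdd.const 3)) .mul
    fun s x y γ hx hy => by simp [Expr.eval, Expr.cost, hx, hy]; omega

theorem Comp.div {f g : α → ℕ} (hf : Comp f) (hg : Comp g) : Comp (fun γ => f γ / g γ) :=
  Comp.binary hf hg (hf.bdd.mono fun γ => Nat.div_le_self _ _)
    ((hf.bdd.add hg.bdd).add (PolyBdd.const 3)) .div
    fun s x y γ hx hy => by simp [Expr.eval, Expr.cost, hx, hy]; omega

theorem Comp.mod {f g : α → ℕ} (hf : Comp f) (hg : Comp g) : Comp (fun γ => f γ % g γ) :=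
  Comp.binary hf hg (hf.bdd.mono fun γ => Nat.mod_le _ _)
    ((hf.bdd.add hg.bdd).add (PolyBdd.const 3)) .mod
    fun s x y γ hx hy => by simp [Expr.eval, Expr.cost, hx, hy]; omega

theorem Comp.ar {f : α → ℕ} (hf : Comp f) : Comp (fun γ => (inst γ).ar (f γ)) :=
  hf.unary (PolyBdd.N.mono fun γ => (inst γ).ar_le _) (PolyBdd.const 2) fun D =>
    ⟨.cell 0 (.reg D), fun l γ s hs hv => by
      simp [Expr.eval, Expr.cost, hv, (Ctx.rep_state hs).2.2.2.1]⟩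

theorem Comp.cnt {f : α → ℕ} (hf : Comp f) : Comp (fun γ => (inst γ).cnt (f γ)) :=
  hf.unary (PolyBdd.N.mono fun γ => (inst γ).cnt_le _) (PolyBdd.const 2) fun D =>
    ⟨.cell 1 (.reg D), fun l γ s hs hv => by
      simp [Expr.eval, Expr.cost, hv, (Ctx.rep_state hs).2.2.2.2.1]⟩

theorem Comp.typ {f : α → ℕ} (hf : Comp f) : Comp (fun γ => (inst γ).typ (f γ)) :=
  hf.unary (PolyBdd.N.mono fun γ => (inst γ).typ_le _) (PolyBdd.const 2) fun D =>
    ⟨.cell 2 (.reg D), fun l γ s hs hv => by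
      simp [Expr.eval, Expr.cost, hv, (Ctx.rep_state hs).2.2.2.2.2.1]⟩

theorem Comp.out {f : α → ℕ} (hf : Comp f) : Comp (fun γ => (Ctx.state γ).out (f γ)) :=
  hf.unary ((PolyBdd.const 1).mono fun γ => (Ctx.state γ).out_le _) (PolyBdd.const 2) fun D =>
    ⟨.cell 3 (.reg D), fun l γ s hs hv => by
      simp [Expr.eval, Expr.cost, hv, (Ctx.rep_state hs).2.2.2.2.2.2]⟩

/-- Primitive recursion with polynomially bounded values. -/
theorem Comp.iter {b z : α → ℕ} {h : (α × ℕ) × ℕ → ℕ} {B : α → ℕ} (hb : Comp b) (hz : Comp z)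
    (hh : Comp h) (hB : PolyBdd B)
    (hle : ∀ γ, ∀ i ≤ b γ, (Nat.rec (z γ) (fun j a => h ((γ, j), a)) i : ℕ) ≤ B γ) :
    Comp (fun γ => (Nat.rec (z γ) (fun j a => h ((γ, j), a)) (b γ) : ℕ)) := by
  refine ⟨hB.mono fun γ => hle γ _ le_rfl, ?_⟩
  have hbb := hb.bdd
  obtain ⟨_, Tb, hTb, hpb⟩ := hb
  obtain ⟨_, Tz, hTz, hpz⟩ := hz
  obtain ⟨_, Th, ⟨C, hC⟩, hph⟩ := hh
  -- One round runs in the context extended by the counter and the accumulator. Both are bounded, by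
  -- `b γ` and `B γ`, so the time of a round is polynomial in the size of `γ` alone.
  let S : α → ℕ := fun γ => (Ctx.size γ + b γ + B γ + 2) ^ C
  have hS : PolyBdd S := ((((PolyBdd.size).add hbb).add hB).add (PolyBdd.const 2)).pow C
  refine ⟨fun γ => Tb γ + (2 + (Tz γ + (b γ * (S γ + 10) + 4 + 2))),
    hTb.add ((PolyBdd.const 2).add (hTz.add (((hbb.mul (hS.add (PolyBdd.const 10))).add
      (PolyBdd.const 4)).add (PolyBdd.const 2)))), fun l D hl => ?_⟩
  -- Register `D` holds the number of rounds, `D + 1` the counter, `D + 2` the accumulator, and `D +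
  -- 3` receives its next value.
  obtain ⟨pb, hpb⟩ := hpb l D hl
  obtain ⟨pz, hpz⟩ := hpz l (D + 2) (Ctx.below_mono hl (by omega))
  obtain ⟨ph, hph⟩ := hph ((l, D + 1), D + 2) (D + 3)
    ⟨⟨Ctx.below_mono hl (by omega), by change D + 1 < D + 3; omega⟩,
      by change D + 2 < D + 3; omega⟩
  let body : Program := .seq ph (.seq (.assign (D + 2) (.reg (D + 3)))
    (.assign (D + 1) (.add (.reg (D + 1)) (.const 1))))
  let lp : Program := .loop (.sub (.reg D) (.reg (D + 1))) body
  have hloop : ∀ (γ : α) (k i : ℕ) (s : Memory), Ctx.Rep l γ s → s.reg D = b γ →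
      s.reg (D + 1) = i → s.reg (D + 2) = Nat.rec (z γ) (fun j a => h ((γ, j), a)) i →
      i + k = b γ → ∃ s' t, Exec lp s s' t ∧ t ≤ k * (S γ + 10) + 4 ∧
        s'.reg (D + 2) = Nat.rec (z γ) (fun j a => h ((γ, j), a)) (b γ) ∧
        (∀ x < D, s'.reg x = s.reg x) ∧ s'.arr = s.arr := by
    intro γ k
    induction k with
    | zero =>
      intro i s hs h0 h1 h2 hk
      refine ⟨s, _, Exec.loopStop (by simp [Expr.eval, h0, h1]; omega), ?_, ?_, fun _ _ => rfl, rfl⟩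
      · simp [Expr.cost]
      · rw [h2, ← hk]; rfl
    | succ k ih =>
      intro i s hs h0 h1 h2 hk
      obtain ⟨s₁, t₁, hx₁, ht₁, hv₁, hr₁, ha₁⟩ := hph ((γ, i), _) s ⟨⟨hs, h1⟩, h2⟩
      have hT : t₁ ≤ S γ := by
        refine ht₁.trans ((hC _).trans (Nat.pow_le_pow_left ?_ C))
        have := hle γ i (by omega)
        change Ctx.size γ + i + _ + 2 ≤ _
        omega
      let s₂ := s₁.setReg (D + 2) (s₁.reg (D + 3))
      let s₃ := s₂.setReg (D + 1) (s₂.reg (D + 1) + 1)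
      have hr₃ : ∀ x < D + 1, s₃.reg x = s.reg x := fun x hx => by
        rw [Memory.setReg_reg_of_ne _ _ (by omega), Memory.setReg_reg_of_ne _ _ (by omega),
          hr₁ x (by omega)]
      have hb : Exec body s s₃ (t₁ + (((1 : ℕ) + 1) + ((1 + 1 + 1) + 1))) :=
        hx₁.seq ((Exec.assign s₁ (D + 2) (.reg (D + 3))).seq
          (Exec.assign s₂ (D + 1) (.add (.reg (D + 1)) (.const 1))))
      obtain ⟨s', t, hx, ht, hv, hr, ha⟩ := ih (i + 1) s₃
        (Ctx.rep_congr hl (fun x hx => hr₃ x (by omega)) ha₁ hs)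
        ((hr₃ D (by omega)).trans h0)
        (by
          rw [Memory.setReg_reg_self, Memory.setReg_reg_of_ne _ _ (by omega), hr₁ _ (by omega), h1])
        (by rw [Memory.setReg_reg_of_ne _ _ (by omega), Memory.setReg_reg_self, hv₁])
        (by omega)
      refine ⟨s', _, Exec.loopStep (by simp [Expr.eval, h0, h1]; omega) hb hx, ?_, hv,
        fun x hx => (hr x hx).trans (hr₃ x (by omega)), ha.trans ha₁⟩
      simp only [Expr.cost]
      rw [Nat.succ_mul]
      omega
  refine ⟨.seq pb (.seq (.assign (D + 1) (.const 0)) (.seq pz (.seq lp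
    (.assign D (.reg (D + 2)))))), fun γ s hs => ?_⟩
  obtain ⟨s₁, t₁, hx₁, ht₁, hv₁, hr₁, ha₁⟩ := hpb γ s hs
  let s₂ := s₁.setReg (D + 1) 0
  have hs₂ : Ctx.Rep l γ s₂ := Ctx.rep_congr hl (fun x hx => by
    rw [Memory.setReg_reg_of_ne _ _ (by omega), hr₁ x hx]) ha₁ hs
  obtain ⟨s₃, t₃, hx₃, ht₃, hv₃, hr₃, ha₃⟩ := hpz γ s₂ hs₂
  obtain ⟨s₄, t₄, hx₄, ht₄, hv₄, hr₄, ha₄⟩ := hloop γ (b γ) 0 s₃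
    (Ctx.rep_congr hl (fun x hx => hr₃ x (by omega)) ha₃ hs₂)
    (by rw [hr₃ _ (by omega), Memory.setReg_reg_of_ne _ _ (by omega), hv₁])
    (by rw [hr₃ _ (by omega), Memory.setReg_reg_self]) hv₃ (by omega)
  refine ⟨_, _, hx₁.seq ((Exec.assign s₁ (D + 1) (.const 0)).seq (hx₃.seq (hx₄.seq
    (Exec.assign s₄ D (.reg (D + 2)))))), ?_, ?_, ?_, ?_⟩
  · simp only [Expr.cost]; omega
  · rw [Memory.setReg_reg_self]; exact hv₄
  · intro x hx
    rw [Memory.setReg_reg_of_ne _ _ hx.ne, hr₄ x hx, hr₃ x (by omega),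
      Memory.setReg_reg_of_ne _ _ (by omega), hr₁ x hx]
  · exact ha₄.trans (ha₃.trans ha₁)

theorem Comp.sum {b : α → ℕ} {f : α → ℕ → ℕ} (hb : Comp b)
    (hf : Comp (fun γ : α × ℕ => f γ.1 γ.2)) :
    Comp (fun γ => ∑ i ∈ Finset.range (b γ), f γ i) := by
  have key : ∀ γ k, (Nat.rec 0 (fun j a => a + f γ j) k : ℕ) = ∑ i ∈ Finset.range k, f γ i := by
    intro γ k
    induction k with
    | zero => rfl
    | succ k ih => rw [Finset.sum_range_succ, ← ih]
  obtain ⟨C, hC⟩ := hf.bdd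
  have hB : PolyBdd (fun γ : α => b γ * (Ctx.size γ + b γ + 2) ^ C) :=
    hb.bdd.mul (((PolyBdd.size.add hb.bdd).add (PolyBdd.const 2)).pow C)
  have := Comp.iter (h := fun γ => γ.2 + f γ.1.1 γ.1.2) hb (Comp.const 0)
    (Comp.add Comp.snd hf.fst) hB (fun γ i hi => by
      rw [key]
      calc ∑ j ∈ Finset.range i, f γ j ≤ ∑ j ∈ Finset.range i, (Ctx.size γ + b γ + 2) ^ C :=
            Finset.sum_le_sum fun j hj => (hC (γ, j)).trans (Nat.pow_le_pow_left (by
              have := Finset.mem_range.1 hj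
              change Ctx.size γ + j + 2 ≤ _
              omega) C)
        _ = i * (Ctx.size γ + b γ + 2) ^ C := by simp
        _ ≤ _ := Nat.mul_le_mul_right _ hi)
  simpa only [key] using this

/-! ### Decidable properties as functions with values 0 and 1 -/

open Classical in
/-- The truth value of a proposition. -/
noncomputable def ind (p : Prop) : ℕ := if p then 1 else 0

theorem ind_of {p : Prop} (h : p) : ind p = 1 := if_pos h

theorem ind_of_not {p : Prop} (h : ¬p) : ind p = 0 := if_neg h

theorem ind_ne_zero {p : Prop} : ind p ≠ 0 ↔ p := by
  by_cases h : p <;> simp [ind, h]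

theorem ind_le_one (p : Prop) : ind p ≤ 1 := by
  by_cases h : p <;> simp [ind, h]

/-- Properties that are decided in polynomial time. -/
def CompP (p : α → Prop) : Prop := Comp (fun γ => ind (p γ))

theorem CompP.of_iff {p q : α → Prop} (hp : CompP p) (h : ∀ γ, q γ ↔ p γ) : CompP q := by
  have : q = p := funext fun γ => propext (h γ)
  rwa [this]

theorem Comp.ne_zero {f : α → ℕ} (hf : Comp f) : CompP (fun γ => f γ ≠ 0) := by
  have : (fun γ => ind (f γ ≠ 0)) = fun γ => 1 - (1 - f γ) := by
    funext γ
    rcases Nat.eq_zero_or_pos (f γ) with h | h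
    · simp [ind, h]
    · rw [ind_of h.ne']; omega
  unfold CompP
  rw [this]
  exact (Comp.const 1).sub ((Comp.const 1).sub hf)

theorem Comp.le {f g : α → ℕ} (hf : Comp f) (hg : Comp g) : CompP (fun γ => f γ ≤ g γ) := by
  have : (fun γ => ind (f γ ≤ g γ)) = fun γ => 1 - (f γ - g γ) := by
    funext γ
    by_cases h : f γ ≤ g γ
    · rw [ind_of h]; omega
    · rw [ind_of_not h]; omega
  unfold CompP
  rw [this]
  exact (Comp.const 1).sub (hf.sub hg)

theorem Comp.lt {f g : α → ℕ} (hf : Comp f) (hg : Comp g) : CompP (fun γ => f γ < g γ) :=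
  (Comp.le (hf.add (Comp.const 1)) hg).of_iff fun _ => Iff.rfl

theorem CompP.not {p : α → Prop} (hp : CompP p) : CompP (fun γ => ¬p γ) :=
  (Comp.le hp (Comp.const 0)).of_iff fun γ => by
    rw [Nat.le_zero, ← not_iff_not, not_not]; exact ind_ne_zero.symm

theorem CompP.and {p q : α → Prop} (hp : CompP p) (hq : CompP q) : CompP (fun γ => p γ ∧ q γ) :=
  (Comp.ne_zero (hp.mul hq)).of_iff fun γ => by
    rw [mul_ne_zero_iff, ind_ne_zero, ind_ne_zero]

theorem CompP.or {p q : α → Prop} (hp : CompP p) (hq : CompP q) : CompP (fun γ => p γ ∨ q γ) :=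
  (hp.not.and hq.not).not.of_iff fun γ => by tauto

theorem CompP.imp {p q : α → Prop} (hp : CompP p) (hq : CompP q) : CompP (fun γ => p γ → q γ) :=
  (hp.and hq.not).not.of_iff fun γ => by tauto

theorem CompP.iff {p q : α → Prop} (hp : CompP p) (hq : CompP q) :
    CompP (fun γ => p γ ↔ q γ) :=
  ((hp.imp hq).and (hq.imp hp)).of_iff fun γ => by tauto

theorem Comp.eq {f g : α → ℕ} (hf : Comp f) (hg : Comp g) : CompP (fun γ => f γ = g γ) :=
  ((Comp.le hf hg).and (Comp.le hg hf)).of_iff fun _ => le_antisymm_iff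

theorem Comp.dvd {f g : α → ℕ} (hf : Comp f) (hg : Comp g) : CompP (fun γ => f γ ∣ g γ) :=
  (Comp.eq (hg.mod hf) (Comp.const 0)).of_iff fun _ => Nat.dvd_iff_mod_eq_zero

/-- The search is exhaustive: the number of witnesses is a polynomially bounded sum. -/
theorem CompP.ex {b : α → ℕ} {p : α → ℕ → Prop} (hb : Comp b)
    (hp : CompP (fun γ : α × ℕ => p γ.1 γ.2)) : CompP (fun γ => ∃ i < b γ, p γ i) :=
  (Comp.ne_zero (Comp.sum (f := fun γ i => ind (p γ i)) hb hp)).of_iff fun γ => by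
    rw [Ne, Finset.sum_eq_zero_iff]
    push Not
    simp only [Finset.mem_range, ind_ne_zero]

theorem CompP.all {b : α → ℕ} {p : α → ℕ → Prop} (hb : Comp b)
    (hp : CompP (fun γ : α × ℕ => p γ.1 γ.2)) : CompP (fun γ => ∀ i < b γ, p γ i) :=
  (CompP.ex (p := fun γ i => ¬p γ i) hb hp.not).not.of_iff fun γ => by push Not; rfl

-- Both branches are evaluated and weighted by the indicators of the condition and of its negation.
open Classical in
theorem Comp.ite {p : α → Prop} {f g : α → ℕ} (hp : CompP p) (hf : Comp f) (hg : Comp g) :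
    Comp (fun γ => if p γ then f γ else g γ) := by
  have : (fun γ => if p γ then f γ else g γ) = fun γ => ind (p γ) * f γ + ind (¬p γ) * g γ := by
    funext γ
    by_cases h : p γ <;> simp [ind, h]
  rw [this]
  exact (Comp.mul hp hf).add (Comp.mul hp.not hg)

end

/-! ### The defining condition of the constructed structure, in terms of numbers -/

/-- The digit of `x` at position `i` in base `b`. -/
def dig (b x i : ℕ) : ℕ := x / b ^ i % b

namespace Inst
variable (I : Inst)

/-- The number of tuples for the relation `R` over `x` elements. -/
def pw (x R : ℕ) : ℕ := min x (I.n + I.c) ^ I.ar R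

/-- The position of the table of the relation `R` in the encoding of a structure. -/
def off (x R : ℕ) : ℕ := ∑ r ∈ Finset.range R, I.pw x r

/-- The position of the `i`-th `k`-type in the list of types. -/
def typePos (k i : ℕ) : ℕ :=
  ∑ j ∈ Finset.range k, I.cnt j * I.off (j + I.c) I.m + i * I.off (k + I.c) I.m

/-- The length of the blocks of elements that agree in their codes. -/
def block : ℕ := Nat.sqrt (Nat.sqrt I.n)

/-- The base for the digits of codes. -/
def base : ℕ := Nat.log 2 I.n * Nat.log 2 I.n

/-- The total number of types. -/
def numTypes : ℕ := ∑ k ∈ Finset.range (I.n + 1), I.cnt k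

/-- The code of the element `b`. -/
def code (b : ℕ) : ℕ := b / I.block

/-- The length of the tuples for which the element `b` serves as an extension. -/
def rank (b : ℕ) : ℕ :=
  if I.cnt (I.code b / I.numTypes % I.base + 1) = 0 then 0 else I.code b / I.numTypes % I.base

/-- The index of the type that the element `b` realises together with these tuples. -/
def index (b : ℕ) : ℕ := I.code b % I.numTypes % I.cnt (I.rank b + 1)

/-- The modulus that `b` applies to other elements. -/
def modulus (b : ℕ) : ℕ := I.code b / I.numTypes / I.base % I.base + 1

/-- The residue that `b` expects of the element in place `j`. -/
def residue (b j : ℕ) : ℕ := dig I.base (I.code b / I.numTypes / I.base / I.base) j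

/-- The place that `b` assigns to the element `e`. -/
noncomputable def place (b e : ℕ) : ℕ :=
  if e = b then I.rank b
  else if I.n ≤ e then e - I.n + (I.rank b + 1)
  else min (I.rank b) (∑ j ∈ Finset.range (I.rank b),
    ind (I.residue b j = (e + 1) % I.modulus b) * j)

/-- The asymmetric relation that makes the owner of a set of elements unique. -/
def Beats (b e : ℕ) : Prop := I.modulus e ∣ b + 1 ∧ ¬I.modulus b ∣ e + 1

/-- The element in place `i` of the tuple `t`. -/
def elt (t i : ℕ) : ℕ := dig (I.n + I.c) t i

/-- The element `b` owns the set of unnamed elements of the tuple `t` for the relation `R`. -/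
def Owns (b R t : ℕ) : Prop :=
  ((∃ i < I.ar R, I.elt t i = b) ∨ ∀ i < I.ar R, I.n ≤ I.elt t i) ∧
  (∀ i < I.ar R, I.elt t i < I.n → I.elt t i ≠ b → I.Beats b (I.elt t i)) ∧
  ∀ i < I.ar R, ∀ j < I.ar R, I.place b (I.elt t i) = I.place b (I.elt t j) →
    I.elt t i = I.elt t j

/-- The truth value that the type chosen by `b` proposes for the atom `R(t)`. -/
def Bit (b R t : ℕ) : Prop :=
  ∃ u < I.pw (I.rank b + 1 + I.c) R,
    (∀ i < I.ar R, dig (I.rank b + 1 + I.c) u i = I.place b (I.elt t i)) ∧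
    I.typ (I.typePos (I.rank b + 1) (I.index b) + I.off (I.rank b + 1 + I.c) R + u) ≠ 0

/-- The type chosen by `b` agrees with `O` on the atoms over the elements of `t` that do not
mention all of its unnamed elements. -/
def Agrees (O : ℕ → ℕ) (b R t : ℕ) : Prop :=
  ∀ R' < I.m, ∀ t' < I.pw (I.n + I.c) R',
    (∀ i < I.ar R', I.n ≤ I.elt t' i ∨ ∃ j < I.ar R, I.elt t j = I.elt t' i) →
    (∃ j < I.ar R, I.elt t j < I.n ∧ ∀ i < I.ar R', I.elt t' i ≠ I.elt t j) →
    (O (I.off (I.n + I.c) R' + t') ≠ 0 ↔ I.Bit b R' t')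

/-- The new truth value of the atom `R(t)`. -/
def Holds (O : ℕ → ℕ) (R t : ℕ) : Prop :=
  ∃ b < I.n, I.Owns b R t ∧ I.Agrees O b R t ∧ I.Bit b R t

/-- The new truth value of the atom at position `x`. -/
def HoldsAt (O : ℕ → ℕ) (x : ℕ) : Prop :=
  ∃ R < I.m, ∃ t < I.pw (I.n + I.c) R, x = I.off (I.n + I.c) R + t ∧ I.Holds O R t

end Inst

/-! ### Polynomial time evaluation of the defining condition -/

section
variable {α : Type} [Ctx α]

/-- Dividing repeatedly by `b` keeps every intermediate value below `x`, whereas the power `b ^ i`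
need not be polynomially bounded. -/
theorem Comp.divPow {x b i : α → ℕ} (hx : Comp x) (hb : Comp b) (hi : Comp i) :
    Comp (fun γ => x γ / b γ ^ i γ) := by
  have key : ∀ γ k, (Nat.rec (x γ) (fun _ a => a / b γ) k : ℕ) = x γ / b γ ^ k := by
    intro γ k
    induction k with
    | zero => simp
    | succ k ih => rw [pow_succ, ← Nat.div_div_eq_div_mul, ← ih]
  have := Comp.iter (h := fun γ => γ.2 / b γ.1.1) hi hx (Comp.div Comp.snd hb.fst.fst) hx.bdd
    (fun γ k _ => by rw [key]; exact Nat.div_le_self _ _)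
  simpa only [key] using this

theorem Comp.dig {b x i : α → ℕ} (hb : Comp b) (hx : Comp x) (hi : Comp i) :
    Comp (fun γ => dig (b γ) (x γ) (i γ)) :=
  (hx.divPow hb hi).mod hb

theorem Comp.min {f g : α → ℕ} (hf : Comp f) (hg : Comp g) : Comp (fun γ => min (f γ) (g γ)) := by
  have : (fun γ => Min.min (f γ) (g γ)) = fun γ => f γ - (f γ - g γ) := by
    funext γ; omega
  rw [this]
  exact hf.sub (hf.sub hg)

theorem sum_ind_lt (n s : ℕ) : ∑ i ∈ Finset.range n, ind (i < s) = min n s := by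
  induction n with
  | zero => simp
  | succ n ih =>
    rw [Finset.sum_range_succ, ih]
    by_cases h : n < s
    · rw [ind_of h]; omega
    · rw [ind_of_not h]; omega

/-- The root counts the positive integers whose square is at most `f`; the logarithm below is
treated in the same way. -/
theorem Comp.sqrt {f : α → ℕ} (hf : Comp f) : Comp (fun γ => Nat.sqrt (f γ)) := by
  have : (fun γ => Nat.sqrt (f γ)) =
      fun γ => ∑ i ∈ Finset.range (f γ), ind ((i + 1) * (i + 1) ≤ f γ) := by
    funext γ
    simp only [← Nat.le_sqrt]
    exact ((sum_ind_lt _ _).trans (min_eq_right (Nat.sqrt_le_self _))).symm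
  rw [this]
  exact Comp.sum hf (Comp.le ((Comp.snd.add (Comp.const 1)).mul (Comp.snd.add (Comp.const 1)))
    hf.fst)

theorem Comp.log {f : α → ℕ} (hf : Comp f) : Comp (fun γ => Nat.log 2 (f γ)) := by
  have : (fun γ => Nat.log 2 (f γ)) =
      fun γ => ∑ i ∈ Finset.range (f γ), ind (f γ / 2 ^ (i + 1) ≠ 0) := by
    funext γ
    rcases Nat.eq_zero_or_pos (f γ) with h | h
    · simp [h]
    have : ∀ i, (f γ / 2 ^ (i + 1) ≠ 0) = (i < Nat.log 2 (f γ)) := fun i => by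
      rw [Nat.div_ne_zero_iff, ← Nat.succ_le_iff, Nat.le_log_iff_pow_le (by norm_num) h.ne']
      simp
    simp only [this]
    exact ((sum_ind_lt _ _).trans (min_eq_right (Nat.log_le_self _ _))).symm
  rw [this]
  exact Comp.sum hf (Comp.ne_zero (hf.fst.divPow (Comp.const 2) (Comp.snd.add (Comp.const 1))))

/-- The truncation at `n + c` in `Inst.pw` makes the power polynomially bounded for every `x`; the
arguments that occur in the construction are not affected by it. -/
theorem Comp.pw {x R : α → ℕ} (hx : Comp x) (hR : Comp R) :
    Comp (fun γ => (inst γ).pw (x γ) (R γ)) := by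
  have key : ∀ (y k : ℕ), (Nat.rec 1 (fun _ a => a * y) k : ℕ) = y ^ k := by
    intro y k
    induction k with
    | zero => simp
    | succ k ih => rw [pow_succ, ← ih]
  have := Comp.iter (b := fun γ : α => (inst γ).ar (R γ)) (z := fun _ => 1)
    (h := fun γ => γ.2 * Min.min (x γ.1.1) ((inst γ.1.1).n + (inst γ.1.1).c)) (Comp.ar hR)
    (Comp.const 1) (Comp.mul Comp.snd (hx.min (Comp.n.add Comp.c)).fst.fst)
    (PolyBdd.N.add (PolyBdd.const 1)) (fun γ k hk => by
      refine (key (Min.min (x γ) ((inst γ).n + (inst γ).c)) k).le.trans ?_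
      refine (Nat.pow_le_pow_left (min_le_right _ _) k).trans ?_
      -- If `n + c = 0`, the initial value `1` of the product may exceed `N`; this is the reason for
      -- the bound `N + 1`.
      rcases Nat.eq_zero_or_pos ((inst γ).n + (inst γ).c) with h | h
      · rw [h]
        rcases Nat.eq_zero_or_pos k with rfl | hk
        · simp
        · rw [Nat.zero_pow hk]; omega
      · exact (Nat.pow_le_pow_right h hk).trans (((inst γ).pow_le _).trans (Nat.le_succ _)))
  simp only [key] at this
  exact this

theorem Comp.off {x R : α → ℕ} (hx : Comp x) (hR : Comp R) :
    Comp (fun γ => (inst γ).off (x γ) (R γ)) :=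
  Comp.sum (f := fun γ r => (inst γ).pw (x γ) r) hR (Comp.pw (α := α × ℕ) hx.fst Comp.snd)

theorem Comp.typePos {k i : α → ℕ} (hk : Comp k) (hi : Comp i) :
    Comp (fun γ => (inst γ).typePos (k γ) (i γ)) :=
  Comp.add (Comp.sum (f := fun γ j => (inst γ).cnt j * (inst γ).off (j + (inst γ).c) (inst γ).m) hk
    (Comp.mul (Comp.cnt (α := α × ℕ) Comp.snd) (Comp.off (α := α × ℕ)
      (Comp.snd.add Comp.c.fst) Comp.m.fst)))
    (hi.mul (Comp.off (hk.add Comp.c) Comp.m))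

theorem Comp.block : Comp (fun γ : α => (inst γ).block) := Comp.n.sqrt.sqrt

theorem Comp.base : Comp (fun γ : α => (inst γ).base) := Comp.n.log.mul Comp.n.log

theorem Comp.numTypes : Comp (fun γ : α => (inst γ).numTypes) :=
  Comp.sum (f := fun γ k => (inst γ).cnt k) (Comp.n.add (Comp.const 1))
    (Comp.cnt (α := α × ℕ) Comp.snd)

theorem Comp.code {b : α → ℕ} (hb : Comp b) : Comp (fun γ => (inst γ).code (b γ)) :=
  hb.div Comp.block

theorem Comp.rank {b : α → ℕ} (hb : Comp b) : Comp (fun γ => (inst γ).rank (b γ)) := by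
  have h := ((Comp.code hb).div Comp.numTypes).mod Comp.base
  convert Comp.ite (Comp.eq (Comp.cnt (h.add (Comp.const 1))) (Comp.const 0)) (Comp.const 0) h
    using 2
  unfold Inst.rank
  congr

theorem Comp.index {b : α → ℕ} (hb : Comp b) : Comp (fun γ => (inst γ).index (b γ)) :=
  ((Comp.code hb).mod Comp.numTypes).mod (Comp.cnt ((Comp.rank hb).add (Comp.const 1)))

theorem Comp.modulus {b : α → ℕ} (hb : Comp b) : Comp (fun γ => (inst γ).modulus (b γ)) :=
  ((((Comp.code hb).div Comp.numTypes).div Comp.base).mod Comp.base).add (Comp.const 1)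

theorem Comp.residue {b j : α → ℕ} (hb : Comp b) (hj : Comp j) :
    Comp (fun γ => (inst γ).residue (b γ) (j γ)) :=
  Comp.dig Comp.base ((((Comp.code hb).div Comp.numTypes).div Comp.base).div Comp.base) hj

theorem Comp.place {b e : α → ℕ} (hb : Comp b) (he : Comp e) :
    Comp (fun γ => (inst γ).place (b γ) (e γ)) := by
  have h := Comp.sum (f := fun γ j => ind ((inst γ).residue (b γ) j =
    (e γ + 1) % (inst γ).modulus (b γ)) * j) (Comp.rank hb) (Comp.mul
      (Comp.eq (Comp.residue (α := α × ℕ) hb.fst Comp.snd)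
        ((he.fst.add (Comp.const 1)).mod (Comp.modulus hb).fst)) Comp.snd)
  convert Comp.ite (Comp.eq he hb) (Comp.rank hb) (Comp.ite (Comp.le Comp.n he)
    ((he.sub Comp.n).add ((Comp.rank hb).add (Comp.const 1))) ((Comp.rank hb).min h)) using 2
  unfold Inst.place
  congr

theorem CompP.beats {b e : α → ℕ} (hb : Comp b) (he : Comp e) :
    CompP (fun γ => (inst γ).Beats (b γ) (e γ)) :=
  (Comp.dvd (Comp.modulus he) (hb.add (Comp.const 1))).and
    (Comp.dvd (Comp.modulus hb) (he.add (Comp.const 1))).not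

theorem Comp.elt {t i : α → ℕ} (ht : Comp t) (hi : Comp i) :
    Comp (fun γ => (inst γ).elt (t γ) (i γ)) :=
  Comp.dig (Comp.n.add Comp.c) ht hi

theorem CompP.owns {b R t : α → ℕ} (hb : Comp b) (hR : Comp R) (ht : Comp t) :
    CompP (fun γ => (inst γ).Owns (b γ) (R γ) (t γ)) := by
  have hA := Comp.ar hR
  have he : Comp (fun γ : α × ℕ => (inst γ).elt (t γ.1) γ.2) := Comp.elt ht.fst Comp.snd
  have he₁ : Comp (fun γ : (α × ℕ) × ℕ => (inst γ).elt (t γ.1.1) γ.1.2) :=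
    Comp.elt ht.fst.fst Comp.snd.fst
  have he₂ : Comp (fun γ : (α × ℕ) × ℕ => (inst γ).elt (t γ.1.1) γ.2) :=
    Comp.elt ht.fst.fst Comp.snd
  refine ((CompP.ex (p := fun γ i => (inst γ).elt (t γ) i = b γ) hA (he.eq hb.fst)).or
    (CompP.all (p := fun γ i => (inst γ).n ≤ (inst γ).elt (t γ) i) hA (Comp.n.fst.le he))).and
    ((CompP.all (p := fun γ i => (inst γ).elt (t γ) i < (inst γ).n → (inst γ).elt (t γ) i ≠ b γ →
      (inst γ).Beats (b γ) ((inst γ).elt (t γ) i)) hA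
      ((he.lt Comp.n.fst).imp ((he.eq hb.fst).not.imp (CompP.beats (α := α × ℕ) hb.fst he)))).and
    (CompP.all (p := fun γ i => ∀ j < (inst γ).ar (R γ),
      (inst γ).place (b γ) ((inst γ).elt (t γ) i) = (inst γ).place (b γ) ((inst γ).elt (t γ) j) →
      (inst γ).elt (t γ) i = (inst γ).elt (t γ) j) hA (CompP.all (p := fun γ j =>
      (inst γ).place (b γ.1) ((inst γ).elt (t γ.1) γ.2) =
        (inst γ).place (b γ.1) ((inst γ).elt (t γ.1) j) →
      (inst γ).elt (t γ.1) γ.2 = (inst γ).elt (t γ.1) j) hA.fst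
      (((Comp.place (α := (α × ℕ) × ℕ) hb.fst.fst he₁).eq
        (Comp.place (α := (α × ℕ) × ℕ) hb.fst.fst he₂)).imp (he₁.eq he₂)))))

theorem CompP.bit {b R t : α → ℕ} (hb : Comp b) (hR : Comp R) (ht : Comp t) :
    CompP (fun γ => (inst γ).Bit (b γ) (R γ) (t γ)) := by
  have hk := (Comp.rank hb).add (Comp.const 1)
  exact CompP.ex (p := fun γ u => (∀ i < (inst γ).ar (R γ),
      dig ((inst γ).rank (b γ) + 1 + (inst γ).c) u i =
        (inst γ).place (b γ) ((inst γ).elt (t γ) i)) ∧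
      (inst γ).typ ((inst γ).typePos ((inst γ).rank (b γ) + 1) ((inst γ).index (b γ)) +
        (inst γ).off ((inst γ).rank (b γ) + 1 + (inst γ).c) (R γ) + u) ≠ 0)
    (Comp.pw (hk.add Comp.c) hR)
    ((CompP.all (p := fun γ i => dig ((inst γ).rank (b γ.1) + 1 + (inst γ).c) γ.2 i =
        (inst γ).place (b γ.1) ((inst γ).elt (t γ.1) i)) (Comp.ar hR).fst
      ((Comp.dig (hk.add Comp.c).fst.fst Comp.snd.fst Comp.snd).eq
        (Comp.place (α := (α × ℕ) × ℕ) hb.fst.fst (Comp.elt ht.fst.fst Comp.snd)))).and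
      (Comp.ne_zero (Comp.typ (α := α × ℕ) (((Comp.typePos hk (Comp.index hb)).add
        (Comp.off (hk.add Comp.c) hR)).fst.add Comp.snd))))

theorem CompP.agrees {b R t : α → ℕ} (hb : Comp b) (hR : Comp R) (ht : Comp t) :
    CompP (fun γ => (inst γ).Agrees (Ctx.state γ).out (b γ) (R γ) (t γ)) := by
  have hA : Comp (fun γ : (α × ℕ) × ℕ => (inst γ).ar (R γ.1.1)) := (Comp.ar hR).fst.fst
  have hA' : Comp (fun γ : (α × ℕ) × ℕ => (inst γ).ar γ.1.2) := Comp.ar Comp.snd.fst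
  have e₁ : Comp (fun γ : ((α × ℕ) × ℕ) × ℕ => (inst γ).elt γ.1.2 γ.2) :=
    Comp.elt Comp.snd.fst Comp.snd
  have e₂ : Comp (fun γ : ((α × ℕ) × ℕ) × ℕ => (inst γ).elt (t γ.1.1.1) γ.2) :=
    Comp.elt ht.fst.fst.fst Comp.snd
  have f₁ : Comp (fun γ : (((α × ℕ) × ℕ) × ℕ) × ℕ => (inst γ).elt γ.1.1.2 γ.2) :=
    Comp.elt Comp.snd.fst.fst Comp.snd
  have f₂ : Comp (fun γ : (((α × ℕ) × ℕ) × ℕ) × ℕ => (inst γ).elt (t γ.1.1.1.1) γ.2) :=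
    Comp.elt ht.fst.fst.fst.fst Comp.snd
  have h₁ : CompP (fun γ : (α × ℕ) × ℕ => ∀ i < (inst γ).ar γ.1.2,
      (inst γ).n ≤ (inst γ).elt γ.2 i ∨
        ∃ j < (inst γ).ar (R γ.1.1), (inst γ).elt (t γ.1.1) j = (inst γ).elt γ.2 i) :=
    CompP.all (p := fun γ i => (inst γ).n ≤ (inst γ).elt γ.2 i ∨
        ∃ j < (inst γ).ar (R γ.1.1), (inst γ).elt (t γ.1.1) j = (inst γ).elt γ.2 i) hA'
      ((Comp.n.fst.le e₁).or (CompP.ex (p := fun γ j => (inst γ).elt (t γ.1.1.1) j =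
        (inst γ).elt γ.1.2 γ.2) hA.fst (f₂.eq e₁.fst)))
  have h₂ : CompP (fun γ : (α × ℕ) × ℕ => ∃ j < (inst γ).ar (R γ.1.1),
      (inst γ).elt (t γ.1.1) j < (inst γ).n ∧
        ∀ i < (inst γ).ar γ.1.2, (inst γ).elt γ.2 i ≠ (inst γ).elt (t γ.1.1) j) :=
    CompP.ex (p := fun γ j => (inst γ).elt (t γ.1.1) j < (inst γ).n ∧
        ∀ i < (inst γ).ar γ.1.2, (inst γ).elt γ.2 i ≠ (inst γ).elt (t γ.1.1) j) hA
      ((e₂.lt Comp.n.fst).and (CompP.all (p := fun γ i => (inst γ).elt γ.1.2 i ≠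
        (inst γ).elt (t γ.1.1.1) γ.2) hA'.fst (f₁.eq e₂.fst).not))
  have h₃ : CompP (fun γ : (α × ℕ) × ℕ =>
      ((Ctx.state γ).out ((inst γ).off ((inst γ).n + (inst γ).c) γ.1.2 + γ.2) ≠ 0 ↔
        (inst γ).Bit (b γ.1.1) γ.1.2 γ.2)) :=
    (Comp.ne_zero (Comp.out ((Comp.off (α := (α × ℕ) × ℕ) (Comp.n.add Comp.c)
      Comp.snd.fst).add Comp.snd))).iff
      (CompP.bit (α := (α × ℕ) × ℕ) hb.fst.fst Comp.snd.fst Comp.snd)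
  exact CompP.all (p := fun γ R' => ∀ t' < (inst γ).pw ((inst γ).n + (inst γ).c) R', _) Comp.m
    (CompP.all (p := fun γ t' => _) (Comp.pw (α := α × ℕ) (Comp.n.add Comp.c) Comp.snd)
      (h₁.imp (h₂.imp h₃)))

theorem CompP.holds {R t : α → ℕ} (hR : Comp R) (ht : Comp t) :
    CompP (fun γ => (inst γ).Holds (Ctx.state γ).out (R γ) (t γ)) :=
  CompP.ex (p := fun γ b => (inst γ).Owns b (R γ) (t γ) ∧
    (inst γ).Agrees (Ctx.state γ).out b (R γ) (t γ) ∧ (inst γ).Bit b (R γ) (t γ)) Comp.n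
    ((CompP.owns (α := α × ℕ) Comp.snd hR.fst ht.fst).and
      ((CompP.agrees (α := α × ℕ) Comp.snd hR.fst ht.fst).and
        (CompP.bit (α := α × ℕ) Comp.snd hR.fst ht.fst)))

theorem CompP.holdsAt {x : α → ℕ} (hx : Comp x) :
    CompP (fun γ => (inst γ).HoldsAt (Ctx.state γ).out (x γ)) :=
  CompP.ex (p := fun γ R => ∃ t < (inst γ).pw ((inst γ).n + (inst γ).c) R,
    x γ = (inst γ).off ((inst γ).n + (inst γ).c) R + t ∧
      (inst γ).Holds (Ctx.state γ).out R t) Comp.m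
    (CompP.ex (p := fun γ t => x γ.1 = (inst γ).off ((inst γ).n + (inst γ).c) γ.2 + t ∧
      (inst γ).Holds (Ctx.state γ).out γ.2 t)
      (Comp.pw (α := α × ℕ) (Comp.n.add Comp.c) Comp.snd)
      ((Comp.eq hx.fst.fst ((Comp.off (α := (α × ℕ) × ℕ) (Comp.n.add Comp.c)
        Comp.snd.fst).add Comp.snd)).and
        (CompP.holds (α := (α × ℕ) × ℕ) Comp.snd.fst Comp.snd)))

end

/-! ### The main program -/

namespace Inst
variable (I : Inst)

/-- The length of the encoding of the constructed structure. -/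
def total : ℕ := I.off (I.n + I.c) I.m

/-- The content of the output array after `j` updates. -/
noncomputable def outAt : ℕ → ℕ → ℕ
  | 0 => fun _ => 0
  | j + 1 => Function.update (outAt j) (j % I.total) (ind (I.HoldsAt (outAt j) (j % I.total)))

theorem outAt_le (j x : ℕ) : I.outAt j x ≤ 1 := by
  induction j with
  | zero => exact Nat.zero_le 1
  | succ j ih =>
    rw [outAt, Function.update_apply]
    split_ifs
    · exact ind_le_one _
    · exact ih

/-- The state after `j` updates. -/
noncomputable def stateAt (j : ℕ) : State := ⟨I, I.outAt j, I.outAt_le j⟩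

end Inst

theorem Comp.total {α : Type} [Ctx α] : Comp (fun γ : α => (inst γ).total) :=
  Comp.off (Comp.n.add Comp.c) Comp.m

/-- Register 3 holds the number of updates, 4 the counter, 5 the position to be updated and 6 its
new value. The output array is part of the context but not of its size, so the time bound for one
update is uniform along the run. -/
theorem exists_program : ∃ (p : Program) (C : ℕ), ∀ (I : Inst) (s : Memory),
    Ctx.Rep () (I.stateAt 0) s → ∃ s' t, Exec p s s' t ∧ t ≤ (I.N + 2) ^ C ∧
      s'.arr 3 = I.outAt (I.n * I.total) := by
  have hJ : Comp (fun γ : State => (inst γ).n * (inst γ).total) := Comp.n.mul Comp.total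
  have hX : Comp (fun γ : State × ℕ => γ.2 % (inst γ).total) := Comp.snd.mod Comp.total
  have hV : Comp (fun γ : State × ℕ =>
    ind ((inst γ).HoldsAt (Ctx.state γ).out (γ.2 % (inst γ).total))) := CompP.holdsAt hX
  have hJb := hJ.bdd
  obtain ⟨_, TJ, hTJ, hpJ⟩ := hJ
  obtain ⟨_, TX, ⟨CX, hCX⟩, hpX⟩ := hX
  obtain ⟨_, TV, ⟨CV, hCV⟩, hpV⟩ := hV
  obtain ⟨pJ, hpJ⟩ := hpJ () 3 (le_refl 3)
  obtain ⟨pX, hpX⟩ := hpX ((), 4) 5 ⟨by change 3 ≤ 5; omega, by change 4 < 5; omega⟩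
  obtain ⟨pV, hpV⟩ := hpV ((), 4) 6 ⟨by change 3 ≤ 6; omega, by change 4 < 6; omega⟩
  let J : State → ℕ := fun γ => (inst γ).n * (inst γ).total
  let S : State → ℕ := fun γ =>
    (Ctx.size γ + J γ + 2) ^ CX + (Ctx.size γ + J γ + 2) ^ CV
  have hS : PolyBdd S :=
    (((PolyBdd.size.add hJb).add (PolyBdd.const 2)).pow CX).add
      (((PolyBdd.size.add hJb).add (PolyBdd.const 2)).pow CV)
  have hT : PolyBdd (fun γ => TJ γ + (J γ * (S γ + 20) + 10)) :=
    hTJ.add ((hJb.mul (hS.add (PolyBdd.const 20))).add (PolyBdd.const 10))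
  obtain ⟨C, hC⟩ := hT
  let body : Program := .seq pX (.seq pV (.seq (.store 3 (.reg 5) (.reg 6))
    (.assign 4 (.add (.reg 4) (.const 1)))))
  let lp : Program := .loop (.sub (.reg 3) (.reg 4)) body
  refine ⟨.seq pJ (.seq (.assign 4 (.const 0)) lp), C, fun I s hs => ?_⟩
  have hloop : ∀ (k j : ℕ) (s : Memory), Ctx.Rep () (I.stateAt j) s →
      s.reg 3 = I.n * I.total → s.reg 4 = j → j + k = I.n * I.total →
      ∃ s' t, Exec lp s s' t ∧ t ≤ k * (S (I.stateAt 0) + 20) + 4 ∧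
        s'.arr 3 = I.outAt (I.n * I.total) := by
    intro k
    induction k with
    | zero =>
      intro j s hs h3 h4 hk
      refine ⟨s, _, Exec.loopStop (by simp [Expr.eval, h3, h4]; omega), ?_, ?_⟩
      · simp [Expr.cost]
      · rw [← hk]; exact (Ctx.rep_state hs).2.2.2.2.2.2
    | succ k ih =>
      intro j s hs h3 h4 hk
      have hr : Ctx.Rep (α := State × ℕ) ((), 4) (I.stateAt j, j) s := ⟨hs, h4⟩
      obtain ⟨s₁, t₁, hx₁, ht₁, hv₁, hr₁, ha₁⟩ := hpX (I.stateAt j, j) s hr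
      have hs₁ := Ctx.rep_congr (α := State × ℕ) (D := 5)
        ⟨by change 3 ≤ 5; omega, by change 4 < 5; omega⟩ hr₁ ha₁ hr
      obtain ⟨s₂, t₂, hx₂, ht₂, hv₂, hr₂, ha₂⟩ := hpV (I.stateAt j, j) s₁ hs₁
      have hT₁ : t₁ ≤ (I.N + I.n * I.total + 2) ^ CX :=
        ht₁.trans ((hCX _).trans (Nat.pow_le_pow_left (by
          change I.N + j + 2 ≤ I.N + I.n * I.total + 2; omega) _))
      have hT₂ : t₂ ≤ (I.N + I.n * I.total + 2) ^ CV :=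
        ht₂.trans ((hCV _).trans (Nat.pow_le_pow_left (by
          change I.N + j + 2 ≤ I.N + I.n * I.total + 2; omega) _))
      let s₃ := s₂.setCell 3 (s₂.reg 5) (s₂.reg 6)
      let s₄ := s₃.setReg 4 (s₃.reg 4 + 1)
      have hb : Exec body s s₄ (t₁ + (t₂ + (((1 : ℕ) + 1 + 1) + ((1 + 1 + 1) + 1)))) :=
        hx₁.seq (hx₂.seq ((Exec.store s₂ 3 (.reg 5) (.reg 6)).seq
          (Exec.assign s₃ 4 (.add (.reg 4) (.const 1)))))
      have hreg : ∀ x < 4, s₄.reg x = s.reg x := fun x hx => by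
        rw [Memory.setReg_reg_of_ne _ _ hx.ne]
        exact (hr₂ x (by omega)).trans (hr₁ x (by omega))
      have harr : ∀ a, a ≠ 3 → s₄.arr a = s.arr a := fun a ha => by
        rw [← ha₁, ← ha₂]
        exact Function.update_of_ne ha _ _
      have h5 : s₂.reg 5 = j % I.total := (hr₂ 5 (by omega)).trans hv₁
      have hs₄ : Ctx.Rep () (I.stateAt (j + 1)) s₄ := by
        obtain ⟨e0, e1, e2, e3, e4, e5, e6⟩ := Ctx.rep_state hs
        refine ⟨(hreg 0 (by omega)).trans e0, (hreg 1 (by omega)).trans e1,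
          (hreg 2 (by omega)).trans e2, (harr 0 (by omega)).trans e3,
          (harr 1 (by omega)).trans e4, (harr 2 (by omega)).trans e5, ?_⟩
        have : s₂.arr 3 = I.outAt j := by rw [ha₂, ha₁]; exact e6
        change Function.update s₂.arr 3 (Function.update (s₂.arr 3) (s₂.reg 5) (s₂.reg 6)) 3 =
          Function.update (I.outAt j) (j % I.total) (ind (I.HoldsAt (I.outAt j) (j % I.total)))
        rw [Function.update_self, this, h5, hv₂]
        rfl
      obtain ⟨s', t, hx, ht, ha⟩ := ih (j + 1) s₄ hs₄ ((hreg 3 (by omega)).trans h3) (by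
          rw [Memory.setReg_reg_self]
          exact congrArg (· + 1) ((hr₂ 4 (by omega)).trans ((hr₁ 4 (by omega)).trans h4)))
        (by omega)
      refine ⟨s', _, Exec.loopStep (by simp [Expr.eval, h3, h4]; omega) hb hx, ?_, ha⟩
      have hS' : S (I.stateAt 0) =
        (I.N + I.n * I.total + 2) ^ CX + (I.N + I.n * I.total + 2) ^ CV := rfl
      simp only [Expr.cost]
      rw [Nat.succ_mul]
      omega
  obtain ⟨s₁, t₁, hx₁, ht₁, hv₁, hr₁, ha₁⟩ := hpJ (I.stateAt 0) s hs
  let s₂ := s₁.setReg 4 0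
  obtain ⟨s₃, t₃, hx₃, ht₃, ha₃⟩ := hloop (I.n * I.total) 0 s₂
    (Ctx.rep_congr (D := 3) (le_refl 3) (fun x hx => by
      rw [Memory.setReg_reg_of_ne _ _ (by omega), hr₁ x hx]) ha₁ hs)
    (by rw [Memory.setReg_reg_of_ne _ _ (by omega), hv₁]; rfl)
    (Memory.setReg_reg_self _ _ _) (by omega)
  refine ⟨s₃, _, hx₁.seq ((Exec.assign s₁ 4 (.const 0)).seq hx₃), ?_, ha₃⟩
  have := hC (I.stateAt 0)
  have hJ' : J (I.stateAt 0) = I.n * I.total := rfl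
  dsimp only at this
  rw [hJ'] at this
  refine le_trans ?_ this
  simp only [Expr.cost]
  omega

/-! ### The output array is a fixed point -/

/-- If the update rule at `x` depends only on the values at places of smaller rank, then cyclic
updates in place reach a fixed point. -/
theorem cyclic_update_fixed {total M : ℕ} (r : ℕ → ℕ) (hr : ∀ x < total, r x < M)
    (V : (ℕ → ℕ) → ℕ → ℕ)
    (hV : ∀ O O' : ℕ → ℕ, ∀ x < total, (∀ y < total, r y < r x → O y = O' y) → V O x = V O' x)
    (O : ℕ → ℕ → ℕ)
    (hO : ∀ j, O (j + 1) = Function.update (O j) (j % total) (V (O j) (j % total)))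
    {J : ℕ} (hJ : M * total ≤ J) {x : ℕ} (hx : x < total) : O J x = V (O J) x := by
  have ht : 0 < total := by omega
  -- Simultaneous updates first: after `s` of them the values at all places of rank below `s` are
  -- final.
  have hfix : ∀ s, ∀ x < total, r x < s → V^[s + 1] (O 0) x = V^[s] (O 0) x := by
    intro s
    induction s with
    | zero => intro x _ h; omega
    | succ s ih =>
      intro x hx h
      rw [Function.iterate_succ_apply', Function.iterate_succ_apply']
      refine hV _ _ x hx fun y hy hyx => ?_
      rw [← Function.iterate_succ_apply' V, ih y hy (by omega)]
  -- All ranks are below `M`, so this is a fixed point of the simultaneous update.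
  let F := V^[M] (O 0)
  have hF : ∀ x < total, V F x = F x := fun x hx => by
    have := hfix M x hx (hr x hx)
    rwa [Function.iterate_succ_apply'] at this
  -- The updates in place reach the same values: after `s` passes the places of rank below `s` hold
  -- those of `F` and keep them.
  have main : ∀ s j, s * total ≤ j → ∀ x < total, r x < s → O j x = F x := by
    intro s
    induction s with
    | zero => intro j _ x _ h; omega
    | succ s ih =>
      intro j hj x hx hs
      have hw : ∀ j, s * total ≤ j → j % total = x → O (j + 1) x = F x := by
        intro j hj hjx
        rw [hO, hjx, Function.update_self, ← hF x hx]
        exact hV _ _ x hx fun y hy hyx => ih j hj y hy (by omega)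
      -- In the pass that starts at time `s * total`, the place `x` is updated at time `s * total +
      -- x`; every later update of it writes the same value.
      have : ∀ i, O (s * total + x + 1 + i) x = F x := by
        intro i
        induction i with
        | zero => exact hw _ (by omega) (by rw [Nat.mul_add_mod', Nat.mod_eq_of_lt hx])
        | succ i ihi =>
          by_cases h : (s * total + x + 1 + i) % total = x
          · have hle : s * total ≤ s * total + x + 1 + i := by omega
            exact hw _ hle h
          · rw [← add_assoc, hO, Function.update_of_ne (Ne.symm h), ihi]
      have e : j = s * total + x + 1 + (j - (s * total + x + 1)) := by
        rw [Nat.succ_mul] at hj; omega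
      rw [e]
      exact this _
  rw [main M J hJ x hx (hr x hx), ← hF x hx]
  exact hV _ _ x hx fun y hy hyx => (main M J hJ y hy (hr y hy)).symm

/-! ### Structures in which every set of elements follows the proposal of its owner -/

section
variable {σ : Signature} {A : Type}

/-- The unnamed element `x` occurs in the tuple `t`. -/
def Mentions {l c : ℕ} (t : Fin l → A ⊕ Fin c) (x : A) : Prop := ∃ i, t i = Sum.inl x

/-- Every element proposes a type, with a place in it for every element. -/
structure Proposals (σ : Signature) (A : Type) where
  rank : A → ℕ
  type : ∀ b, σ.KType (rank b + 1)
  place : ∀ b, A → Fin (rank b + 1)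
  Beats : A → A → Prop

namespace Proposals
variable (P : Proposals σ A)

/-- The truth value that `b` proposes. -/
def bit (b : A) (R : Fin σ.numRel) (t : Fin (σ.arity R) → A ⊕ Fin σ.numCons) : Bool :=
  P.type b R (Sum.map (P.place b) id ∘ t)

/-- The element `b` owns the set of elements that occur in `t`. -/
structure Owns {l : ℕ} (b : A) (t : Fin l → A ⊕ Fin σ.numCons) : Prop where
  mem : Mentions t b ∨ ∀ x, ¬Mentions t x
  beats : ∀ x, Mentions t x → x ≠ b → P.Beats b x
  inj : ∀ x y, Mentions t x → Mentions t y → P.place b x = P.place b y → x = y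

/-- `B` follows the proposal of `b` on proper subsets of the elements of `t`. -/
def Agrees (B : σ.Str A) {l : ℕ} (b : A) (t : Fin l → A ⊕ Fin σ.numCons) : Prop :=
  ∀ (R : Fin σ.numRel) (t' : Fin (σ.arity R) → A ⊕ Fin σ.numCons),
    (∀ x, Mentions t' x → Mentions t x) → (∃ x, Mentions t x ∧ ¬Mentions t' x) →
    (B R t' = true ↔ P.bit b R t' = true)

/-- `B` is determined by the proposals. -/
def Determines (B : σ.Str A) : Prop :=
  ∀ (R : Fin σ.numRel) (t : Fin (σ.arity R) → A ⊕ Fin σ.numCons),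
    B R t = true ↔ ∃ b, P.Owns b t ∧ P.Agrees B b t ∧ P.bit b R t = true

/-- The proposals agree on the constants. -/
def Consistent : Prop :=
  ∀ (b b' : A) (R : Fin σ.numRel) (t : Fin (σ.arity R) → A ⊕ Fin σ.numCons),
    (∀ x, ¬Mentions t x) → P.bit b R t = P.bit b' R t

variable {P}

theorem Owns.congr {l l' : ℕ} {b : A} {t : Fin l → A ⊕ Fin σ.numCons}
    {t' : Fin l' → A ⊕ Fin σ.numCons} (h : P.Owns b t) (e : ∀ x, Mentions t' x ↔ Mentions t x) :
    P.Owns b t' := by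
  obtain ⟨h₁, h₂, h₃⟩ := h
  simp only [← e] at h₁ h₂ h₃
  exact ⟨h₁, h₂, h₃⟩

theorem Agrees.congr {B : σ.Str A} {l l' : ℕ} {b : A} {t : Fin l → A ⊕ Fin σ.numCons}
    {t' : Fin l' → A ⊕ Fin σ.numCons} (h : P.Agrees B b t)
    (e : ∀ x, Mentions t' x ↔ Mentions t x) : P.Agrees B b t' := by
  unfold Agrees at h ⊢
  simpa only [e] using h

/-- Two distinct owners would both belong to the set and hence beat each other. Non-emptiness
matters: a tuple of constants is owned by every element. -/
theorem Owns.unique (hP : ∀ x y, P.Beats x y → ¬P.Beats y x) {l : ℕ} {b b' x : A}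
    {t : Fin l → A ⊕ Fin σ.numCons} (h : P.Owns b t) (h' : P.Owns b' t) (hx : Mentions t x) :
    b = b' := by
  by_contra hne
  have m : Mentions t b := h.mem.resolve_right fun h => h x hx
  have m' : Mentions t b' := h'.mem.resolve_right fun h => h x hx
  exact hP _ _ (h.beats b' m' (Ne.symm hne)) (h'.beats b m hne)

/-- If the owner of a set has a proposal that agrees with `B`, then `B` follows it. -/
theorem Determines.iff_bit {B : σ.Str A} (hB : P.Determines B)
    (hP : ∀ x y, P.Beats x y → ¬P.Beats y x) (hc : P.Consistent) {l : ℕ} {b : A}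
    {t : Fin l → A ⊕ Fin σ.numCons} (ho : P.Owns b t) (ha : P.Agrees B b t)
    (R : Fin σ.numRel) (t' : Fin (σ.arity R) → A ⊕ Fin σ.numCons)
    (ht : ∀ x, Mentions t' x → Mentions t x) : B R t' = P.bit b R t' := by
  rw [Bool.eq_iff_iff]
  -- On proper subsets this is `Agrees`. On the full set the owner is unique, or there are no
  -- unnamed elements and all proposals coincide.
  by_cases hm : ∃ x, Mentions t x ∧ ¬Mentions t' x
  · exact ha R t' ht hm
  have e : ∀ x, Mentions t' x ↔ Mentions t x := fun x =>
    ⟨ht x, fun h => by by_contra h'; exact hm ⟨x, h, h'⟩⟩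
  rw [hB R t']
  refine ⟨fun ⟨b', ho', _, hb'⟩ => ?_, fun h => ⟨b, ho.congr e, ha.congr e, h⟩⟩
  by_cases hx : ∃ x, Mentions t' x
  · obtain ⟨x, hx⟩ := hx
    rwa [(ho.congr e).unique hP ho' hx]
  · rwa [hc b b' R t' (not_exists.1 hx)]

/-- On the elements of `t` the structure copies the type proposed by the owner, so `a` realises the
type induced on its places there; these are distinct, and closure applies. -/
theorem Determines.tp_mem {τ : ∀ k, Finset (σ.KType k)}
    (hcl : ∀ k ≤ σ.wd, ∀ t ∈ τ k, ∀ (l : ℕ) (f : Fin l → Fin k), Function.Injective f →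
      Signature.Str.tp t f ∈ τ l)
    (hr : ∀ b, P.rank b < σ.wd) (ht : ∀ b, P.type b ∈ τ (P.rank b + 1)) {B : σ.Str A}
    (hB : P.Determines B) (hP : ∀ x y, P.Beats x y → ¬P.Beats y x) (hc : P.Consistent)
    {k l : ℕ} (a : Fin k → A) (ha : Function.Injective a) {b : A}
    {t : Fin l → A ⊕ Fin σ.numCons} (hat : ∀ i, Mentions t (a i)) (ho : P.Owns b t)
    (hag : P.Agrees B b t) : B.tp a ∈ τ k := by
  have : B.tp a = Signature.Str.tp (P.type b) (P.place b ∘ a) := by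
    funext R u
    have := hB.iff_bit hP hc ho hag R (Sum.map a id ∘ u) (by
      rintro x ⟨i, hi⟩
      rcases h : u i with y | y
      · simp only [Function.comp_apply, h, Sum.map_inl, Sum.inl.injEq] at hi
        exact hi ▸ hat y
      · simp [h] at hi)
    change B R _ = _
    rw [this, bit, ← Function.comp_assoc, Sum.map_comp_map]
    rfl
  rw [this]
  exact hcl _ (hr b) _ (ht b) _ _ fun i j h => ha (ho.inj _ _ (hat i) (hat j) h)

/-- For at least two elements, the positive literal that makes the type guarded is a true atom and
hence supplies an owner that agrees with `B`. The empty set is owned by everybody and a singleton by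
its element. -/
theorem Determines.isGuardedBy [Nonempty A] {τ : ∀ k, Finset (σ.KType k)}
    (hcl : ∀ k ≤ σ.wd, ∀ t ∈ τ k, ∀ (l : ℕ) (f : Fin l → Fin k), Function.Injective f →
      Signature.Str.tp t f ∈ τ l)
    (hr : ∀ b, P.rank b < σ.wd) (ht : ∀ b, P.type b ∈ τ (P.rank b + 1)) {B : σ.Str A}
    (hB : P.Determines B) (hP : ∀ x y, P.Beats x y → ¬P.Beats y x) (hc : P.Consistent) :
    IsGuardedBy τ B := by
  have key : ∀ {k l : ℕ} (a : Fin k → A), Function.Injective a → ∀ {b : A}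
    {t : Fin l → A ⊕ Fin σ.numCons}, (∀ i, Mentions t (a i)) → P.Owns b t →
    P.Agrees B b t → B.tp a ∈ τ k :=
    fun a ha _ _ => hB.tp_mem hcl hr ht hP hc a ha
  have empty : ∀ b : A, P.Owns b (Fin.elim0 : Fin 0 → A ⊕ Fin σ.numCons) ∧
      P.Agrees B b (Fin.elim0 : Fin 0 → A ⊕ Fin σ.numCons) := fun b =>
    have h : ∀ x, ¬Mentions (Fin.elim0 : Fin 0 → A ⊕ Fin σ.numCons) x := fun _ ⟨i, _⟩ => i.elim0
    ⟨⟨Or.inr h, fun x hx => (h x hx).elim, fun x _ hx => (h x hx).elim⟩,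
      fun _ _ _ ⟨x, hx, _⟩ => (h x hx).elim⟩
  intro k hk a ha hg
  rcases k with _ | _ | k
  · obtain ⟨b⟩ := ‹Nonempty A›
    exact key a ha (t := Fin.elim0) (fun i => i.elim0) (empty b).1 (empty b).2
  · have hm : ∀ x, Mentions (fun _ : Fin 1 => (Sum.inl (a 0) : A ⊕ Fin σ.numCons)) x ↔ a 0 = x :=
      fun x => ⟨fun ⟨_, h⟩ => Sum.inl_injective h, fun h => ⟨0, congrArg _ h⟩⟩
    refine key a ha (b := a 0) (t := fun _ : Fin 1 => Sum.inl (a 0)) (fun i => ?_) ⟨?_, ?_, ?_⟩ ?_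
    · exact (hm _).2 (congrArg a (Fin.ext (by omega)))
    · exact Or.inl ((hm _).2 rfl)
    · exact fun x hx hne => (hne ((hm x).1 hx).symm).elim
    · exact fun x y hx hy _ => ((hm x).1 hx).symm.trans ((hm y).1 hy)
    -- An atom over a proper subset of a singleton mentions constants only, and there `B` follows
    -- every proposal.
    · rintro R t' hs ⟨x, hx, hx'⟩
      rw [hB.iff_bit hP hc (empty (a 0)).1 (empty (a 0)).2 R t' fun y hy => by
        have h₁ := (hm y).1 (hs y hy)
        rw [hm] at hx
        exact (hx' (hx ▸ h₁ ▸ hy)).elim]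
  · obtain ⟨R, t, hRt, hall⟩ := hg.resolve_left (by omega)
    obtain ⟨b, ho, hag, -⟩ := (hB R (Sum.map a id ∘ t)).1 hRt
    refine key a ha (fun i => ?_) ho hag
    obtain ⟨j, hj⟩ := hall i
    exact ⟨j, by simp [hj]⟩

theorem mentions_map {k l c : ℕ} {s : Fin k → A} (hs : Function.Injective s)
    (t : Fin l → Fin k ⊕ Fin c) (i : Fin k) :
    Mentions (Sum.map s id ∘ t) (s i) ↔ Mentions t i := by
  constructor
  · rintro ⟨j, hj⟩
    rcases h : t j with y | y
    · simp only [Function.comp_apply, h, Sum.map_inl, Sum.inl.injEq] at hj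
      exact ⟨j, by rw [h, hs hj]⟩
    · simp [h] at hj
  · rintro ⟨j, hj⟩
    exact ⟨j, by simp [hj]⟩

theorem exists_of_mentions_map {k l c : ℕ} {s : Fin k → A} {t : Fin l → Fin k ⊕ Fin c} {x : A}
    (h : Mentions (Sum.map s id ∘ t) x) : ∃ i, s i = x ∧ Mentions t i := by
  obtain ⟨j, hj⟩ := h
  rcases h : t j with y | y
  · simp only [Function.comp_apply, h, Sum.map_inl, Sum.inl.injEq] at hj
    exact ⟨y, hj, j, h⟩
  · simp [h] at hj

theorem exists_eq_map {k l c : ℕ} {s : Fin k → A} {t : Fin l → A ⊕ Fin c}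
    (h : ∀ x, Mentions t x → ∃ i, s i = x) :
    ∃ u : Fin l → Fin k ⊕ Fin c, Sum.map s id ∘ u = t := by
  have : ∀ i, ∃ y : Fin k ⊕ Fin c, Sum.map s id y = t i := fun i => by
    rcases hi : t i with x | x
    · obtain ⟨j, hj⟩ := h x ⟨i, hi⟩
      exact ⟨Sum.inl j, by simp [hj]⟩
    · exact ⟨Sum.inr x, rfl⟩
  choose u hu using this
  exact ⟨u, funext hu⟩

/-- Every type over a tuple is proposed by some element that beats all elements of the tuple. -/
def Universal (P : Proposals σ A) (τ : ∀ k, Finset (σ.KType k)) : Prop :=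
  ∀ k < σ.wd, ∀ T ∈ τ (k + 1), ∀ a : Fin k → A, Function.Injective a →
    ∃ b, (∀ i, a i ≠ b) ∧ (∀ i, P.Beats b (a i)) ∧ (∀ i, (P.place b (a i) : ℕ) = i) ∧
      ∃ e : P.rank b = k, ∀ R t, P.type b R (Sum.map (Fin.cast (by rw [e])) id ∘ t) = T R t

/-- The witness `b` from `Universal` works because atoms over `a` alone are settled by the type of
`a`, while every set of elements of `a` and `b` that contains `b` is owned by `b`. -/
theorem Determines.hasExtensionProperty {τ : ∀ k, Finset (σ.KType k)} {B : σ.Str A}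
    (hB : P.Determines B) (hP : ∀ x y, P.Beats x y → ¬P.Beats y x)
    (hself : ∀ b, (P.place b b : ℕ) = P.rank b) (hU : P.Universal τ) :
    HasExtensionProperty τ B := by
  intro k hk τ₁ _ T hT hτ a ha hat
  obtain ⟨b, hb, hbeats, hplace, e, htype⟩ := hU k hk T hT a ha
  refine ⟨b, fun ⟨i, hi⟩ => hb i hi, ?_⟩
  set s : Fin (k + 1) → A := Fin.snoc a b with hs
  have hsl : s (Fin.last k) = b := by simp [hs]
  have hsc : ∀ i : Fin k, s i.castSucc = a i := fun i => by simp [hs]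
  have hps : ∀ i, P.place b (s i) = Fin.cast (by rw [e]) i := by
    intro i
    apply Fin.ext
    refine Fin.lastCases ?_ (fun i => ?_) i
    · simp [hsl, hself, e]
    · simp [hsc, hplace]
  have hsi : Function.Injective s := by
    intro i j h
    have := hps i
    rw [h, hps j] at this
    simpa using this.symm
  have hbit : ∀ R t, P.bit b R (Sum.map s id ∘ t) = T R t := by
    intro R t
    rw [← htype R t, bit, ← Function.comp_assoc, Sum.map_comp_map]
    congr 3
    exact funext hps
  -- Induction on the number of variables in the atom: for an atom with the new variable, the
  -- induction hypothesis yields `Agrees`, so that `b` may decide the atom.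
  suffices h : ∀ (N : ℕ) (R : Fin σ.numRel) (t : Fin (σ.arity R) → Fin (k + 1) ⊕ Fin σ.numCons),
      Set.ncard {i | Mentions t i} < N → B R (Sum.map s id ∘ t) = T R t by
    funext R t
    exact h _ R t (Nat.lt_succ_self _)
  intro N
  induction N with
  | zero => intro R t h; omega
  | succ N ih =>
    intro R t hN
    by_cases hl : Mentions t (Fin.last k)
    · have ho : P.Owns b (Sum.map s id ∘ t) := by
        refine ⟨Or.inl ?_, fun x hx hne => ?_, fun x y hx hy h => ?_⟩
        · rw [← hsl]; exact (mentions_map hsi t _).2 hl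
        · obtain ⟨i, rfl, -⟩ := exists_of_mentions_map hx
          induction i using Fin.lastCases with
          | last => exact (hne hsl).elim
          | cast i => rw [hsc]; exact hbeats i
        · obtain ⟨i, rfl, -⟩ := exists_of_mentions_map hx
          obtain ⟨j, rfl, -⟩ := exists_of_mentions_map hy
          rw [hps, hps] at h
          rw [Fin.cast_injective _ h]
      have hag : P.Agrees B b (Sum.map s id ∘ t) := by
        rintro R' t' hsub ⟨x, hx, hx'⟩
        obtain ⟨u, rfl⟩ := exists_eq_map (s := s) (t := t') fun y hy =>
          (exists_of_mentions_map (hsub y hy)).imp fun _ h => h.1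
        rw [ih R' u, hbit]
        refine lt_of_lt_of_le (Set.ncard_lt_ncard ⟨fun i hi => ?_, fun h => ?_⟩)
          (Nat.le_of_lt_succ hN)
        · exact (mentions_map hsi t i).1 (hsub _ ((mentions_map hsi u i).2 hi))
        · obtain ⟨i, rfl, hi⟩ := exists_of_mentions_map hx
          exact hx' ((mentions_map hsi u i).2 (h hi))
      rw [← hbit R t, Bool.eq_iff_iff, hB]
      refine ⟨fun ⟨b', ho', _, hb'⟩ => ?_, fun h => ⟨b, ho, hag, h⟩⟩
      rwa [ho.unique hP ho' ((mentions_map hsi t _).2 hl)]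
    -- Without the new variable, the atom belongs to the restriction of `T`, which is the type of
    -- `a`.
    · obtain ⟨u, rfl⟩ := exists_eq_map (s := (Fin.castSucc : Fin k → Fin (k + 1))) (t := t) (by
        intro i hi
        induction i using Fin.lastCases with
        | last => exact (hl hi).elim
        | cast i => exact ⟨i, rfl⟩)
      have h₁ : B.tp a R u = Signature.Str.tp T (Fin.castSucc : Fin k → Fin (k + 1)) R u := by
        rw [hat, hτ]
      change B R _ = T R _ at h₁
      rw [← h₁, ← Function.comp_assoc, Sum.map_comp_map]
      congr 3
      exact funext hsc

end Proposals
end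

/-! ### Existence of elements with given codes -/

/-- Few small numbers have a small common non-divisor. -/
theorem exists_not_dvd {ι : Type*} (s : Finset ι) (N : ι → ℕ) {n m : ℕ} (hN : ∀ i ∈ s, 0 < N i)
    (hn : ∀ i ∈ s, N i ≤ n) (hm : 0 < m) (hs : n ^ s.card < 2 ^ m) :
    ∃ p, 0 < p ∧ p ≤ 2 * m ∧ ∀ i ∈ s, ¬p ∣ N i := by
  by_contra! h
  have hprod : ∏ i ∈ s, N i ≤ n ^ s.card := Finset.prod_le_pow_card _ _ _ hn
  have hpos : 0 < ∏ i ∈ s, N i := Finset.prod_pos hN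
  -- Each prime power exactly dividing the central binomial coefficient is at most `2 * m`, so under
  -- the contrary assumption it divides some `N i`.
  have hdvd : m.centralBinom ∣ ∏ i ∈ s, N i := by
    rw [← Nat.factorization_prime_le_iff_dvd (Nat.centralBinom_ne_zero m) hpos.ne']
    intro p hp
    rw [← hp.pow_dvd_iff_le_factorization hpos.ne']
    obtain ⟨i, hi, hd⟩ := h (p ^ m.centralBinom.factorization p) (pow_pos hp.pos _)
      (Nat.pow_factorization_choose_le (by omega))
    exact hd.trans (Finset.dvd_prod_of_mem N hi)
  have h₁ := Nat.le_of_dvd hpos hdvd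
  have h₂ := Nat.four_pow_le_two_mul_self_mul_centralBinom m hm
  have h₃ : 2 * m ≤ 2 ^ m := by
    clear * - hm
    induction m with
    | zero => omega
    | succ m ih =>
      rcases Nat.eq_zero_or_pos m with rfl | h
      · norm_num
      · have := ih h
        have := Nat.one_le_two_pow (n := m)
        rw [pow_succ]
        rcases Nat.lt_or_ge m 2 with h | h
        · interval_cases m; norm_num
        · omega
  -- The lower bound `4 ^ m / (2 * m)` for the binomial coefficient is at least `2 ^ m`, which
  -- exceeds the product.
  have h₄ : (2 : ℕ) ^ m * 2 ^ m ≤ 2 ^ m * n ^ s.card := by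
    calc (2 : ℕ) ^ m * 2 ^ m = 4 ^ m := by rw [← mul_pow]; norm_num
      _ ≤ 2 * m * m.centralBinom := h₂
      _ ≤ 2 ^ m * n ^ s.card := Nat.mul_le_mul h₃ (h₁.trans hprod)
  exact absurd (Nat.le_of_mul_le_mul_left h₄ (by positivity)) (not_le.2 hs)

/-- Every interval of length `E` contains a predecessor of a multiple of `d ≤ E`. -/
theorem exists_div_eq_dvd_succ {E d : ℕ} (v : ℕ) (hd : 0 < d) (hE : d ≤ E) :
    ∃ b, b / E = v ∧ d ∣ b + 1 ∧ b < (v + 1) * E := by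
  have h₁ := Nat.div_add_mod (v * E) d
  have h₂ := Nat.mod_lt (v * E) hd
  have h₃ : d * (v * E / d + 1) = d * (v * E / d) + d := by ring
  -- `b + 1` is the first multiple of `d` strictly above `v * E`.
  refine ⟨d * (v * E / d + 1) - 1, ?_, ?_, ?_⟩
  · rw [Nat.div_eq_iff (by omega)]
    have : (v + 1) * E = v * E + E := by ring
    constructor <;> omega
  · rw [Nat.sub_add_cancel (by omega)]
    exact dvd_mul_right _ _
  · have : (v + 1) * E = v * E + E := by ring
    omega

/-- With `s` the fourth root of `l` rounded down, `l ≤ (s + 1) ^ 4 ≤ 2 ^ (4 * s)` and `w ≤ s`. It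
remains to see `4 * s * (8 * s + 12) ≤ s ^ 4`, which is true from `s = 7` on; this explains `2401 =
7 ^ 4`. -/
theorem pow_le_two_pow {w l : ℕ} (hw : w ^ 4 ≤ l) (hl : 2401 ≤ l) : l ^ (8 * w + 12) ≤ 2 ^ l := by
  obtain ⟨s, h₁, h₂⟩ : ∃ s, s ^ 4 ≤ l ∧ l < (s + 1) ^ 4 := by
    refine ⟨Nat.sqrt (Nat.sqrt l), ?_, ?_⟩
    · have h := Nat.sqrt_le' (Nat.sqrt l)
      calc Nat.sqrt (Nat.sqrt l) ^ 4 = (Nat.sqrt (Nat.sqrt l) ^ 2) ^ 2 := by ring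
        _ ≤ (Nat.sqrt l) ^ 2 := Nat.pow_le_pow_left h 2
        _ ≤ l := Nat.sqrt_le' l
    · have h : Nat.sqrt l + 1 ≤ (Nat.sqrt (Nat.sqrt l) + 1) ^ 2 := Nat.succ_le_succ_sqrt' _
      calc l < (Nat.sqrt l + 1) ^ 2 := Nat.lt_succ_sqrt' l
        _ ≤ ((Nat.sqrt (Nat.sqrt l) + 1) ^ 2) ^ 2 := Nat.pow_le_pow_left h 2
        _ = _ := by ring
  have hs : 7 ≤ s := by
    by_contra h
    have : (s + 1) ^ 4 ≤ 7 ^ 4 := Nat.pow_le_pow_left (by omega) 4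
    omega
  have hws : w ≤ s := by
    by_contra h
    have : (s + 1) ^ 4 ≤ w ^ 4 := Nat.pow_le_pow_left (by omega) 4
    omega
  have hl2 : l ≤ 2 ^ (4 * s) := by
    have : s + 1 ≤ 2 ^ s := Nat.lt_two_pow_self
    calc l ≤ (s + 1) ^ 4 := h₂.le
      _ ≤ (2 ^ s) ^ 4 := Nat.pow_le_pow_left this 4
      _ = 2 ^ (4 * s) := by rw [← pow_mul, mul_comm]
  calc l ^ (8 * w + 12) ≤ (2 ^ (4 * s)) ^ (8 * w + 12) := Nat.pow_le_pow_left hl2 _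
    _ = 2 ^ (4 * s * (8 * w + 12)) := by rw [← pow_mul]
    _ ≤ 2 ^ l := Nat.pow_le_pow_right (by norm_num) ?_
  calc 4 * s * (8 * w + 12) ≤ 4 * s * (8 * s + 12) := by gcongr
    _ ≤ s ^ 4 := by
      obtain ⟨r, rfl⟩ := Nat.exists_eq_add_of_le hs
      ring_nf
      nlinarith [Nat.zero_le r, Nat.zero_le (r ^ 2), Nat.zero_le (r ^ 3), Nat.zero_le (r ^ 4)]
    _ ≤ l := h₁

/-- The parameters of the construction fit into `n`. -/
structure Fits (n w T : ℕ) : Prop where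
  log_le : 2401 ≤ Nat.log 2 n
  pow_le : w ^ 4 ≤ Nat.log 2 n
  block_le : (Nat.log 2 n * Nat.log 2 n) ^ w ≤ Nat.sqrt (Nat.sqrt n)
  code_le : (w + 1) * T * (Nat.log 2 n * Nat.log 2 n) ^ (w + 1) * Nat.sqrt (Nat.sqrt n) ≤ n

/-- The number `T` of types of maximal width is at least doubly exponential in `w`, so `log n`
dominates `w ^ w`, and `l ^ (8 * w + 12) ≤ n` for `l = log n`. Apart from this, only `T ^ 2 ≤ n` is
needed. -/
theorem fits {n w T c : ℕ} (hc : c = 2500) (hw : 0 < w) (hT : 2 ^ (w ^ w) ≤ T)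
    (hn : 2 ^ c * T ^ (2 ^ w) ≤ n) : Fits n w T := by
  have hT0 : 0 < T := lt_of_lt_of_le (by positivity) hT
  have hT1 : T ≤ T ^ (2 ^ w) := Nat.le_self_pow (by positivity) T
  have hn0 : n ≠ 0 := by
    have : 0 < 2 ^ c * T ^ (2 ^ w) := by positivity
    omega
  have hl : c + w ^ w ≤ Nat.log 2 n := by
    rw [Nat.le_log_iff_pow_le (by norm_num) hn0, pow_add]
    exact (Nat.mul_le_mul_left _ (hT.trans hT1)).trans hn
  have hlog : 2401 ≤ Nat.log 2 n := by omega
  -- The constant `2 ^ c` takes care of small `w`, the bound `w ^ w` of the others.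
  have hpow : w ^ 4 ≤ Nat.log 2 n := by
    rcases Nat.lt_or_ge w 7 with h | h
    · have : w ^ 4 ≤ 7 ^ 4 := Nat.pow_le_pow_left h.le 4
      omega
    · have : w ^ 4 ≤ w ^ w := Nat.pow_le_pow_right hw (by omega)
      omega
  have hwl : w + 1 ≤ Nat.log 2 n := by
    rcases Nat.lt_or_ge w 2 with h | h
    · omega
    · have : w ^ 2 ≤ w ^ 4 := Nat.pow_le_pow_right hw (by norm_num)
      nlinarith
  set l := Nat.log 2 n with hldef
  have hX : (w + 1) ^ 4 * l ^ (8 * w + 8) ≤ n :=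
    calc (w + 1) ^ 4 * l ^ (8 * w + 8) ≤ l ^ 4 * l ^ (8 * w + 8) := by gcongr
      _ = l ^ (8 * w + 12) := by rw [← pow_add]; congr 1; omega
      _ ≤ 2 ^ l := pow_le_two_pow hpow hlog
      _ ≤ n := Nat.pow_log_le_self 2 hn0
  have hT2 : T ^ 2 ≤ n := by
    have h2 : 2 ≤ 2 ^ w := Nat.le_self_pow hw.ne' 2
    calc T ^ 2 ≤ T ^ (2 ^ w) := Nat.pow_le_pow_right hT0 h2
      _ ≤ 2 ^ c * T ^ (2 ^ w) := Nat.le_mul_of_pos_left _ (by positivity)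
      _ ≤ n := hn
  have hE : Nat.sqrt (Nat.sqrt n) ^ 4 ≤ n :=
    calc Nat.sqrt (Nat.sqrt n) ^ 4 = (Nat.sqrt (Nat.sqrt n) ^ 2) ^ 2 := by ring
      _ ≤ (Nat.sqrt n) ^ 2 := Nat.pow_le_pow_left (Nat.sqrt_le' _) 2
      _ ≤ n := Nat.sqrt_le' n
  refine ⟨hlog, hpow, ?_, ?_⟩
  · rw [Nat.le_sqrt', Nat.le_sqrt']
    calc (((l * l) ^ w) ^ 2) ^ 2 = l ^ (8 * w) := by
          rw [← pow_two, ← pow_mul, ← pow_mul, ← pow_mul]; ring_nf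
      _ ≤ l ^ (8 * w + 8) := Nat.pow_le_pow_right (by omega) (by omega)
      _ ≤ (w + 1) ^ 4 * l ^ (8 * w + 8) := Nat.le_mul_of_pos_left _ (by positivity)
      _ ≤ n := hX
  -- After taking fourth powers, the types contribute at most `n ^ 2`, the digits of the code at
  -- most `n`, and the block length at most `n`.
  · rw [← Nat.pow_le_pow_iff_left (n := 4) (by norm_num)]
    have e : (l * l) ^ (w + 1) = l ^ (2 * w + 2) := by rw [← pow_two, ← pow_mul, mul_add_one]
    have e' : (l ^ (2 * w + 2)) ^ 4 = l ^ (8 * w + 8) := by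
      rw [← pow_mul]; congr 1; omega
    calc ((w + 1) * T * (l * l) ^ (w + 1) * Nat.sqrt (Nat.sqrt n)) ^ 4
        = (T ^ 2) ^ 2 * ((w + 1) ^ 4 * (l ^ (2 * w + 2)) ^ 4) *
            Nat.sqrt (Nat.sqrt n) ^ 4 := by rw [e]; ring
      _ = (T ^ 2) ^ 2 * ((w + 1) ^ 4 * l ^ (8 * w + 8)) *
            Nat.sqrt (Nat.sqrt n) ^ 4 := by rw [e']
      _ ≤ n ^ 2 * n * n := by gcongr
      _ = n ^ 4 := by ring

/-- The code of `b` is assembled from the index of the type, the rank, a modulus `p` that separates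
the tuple, and the residues. The position inside the block remains free and serves to make `b + 1`
divisible by the moduli of the tuple. -/
theorem Fits.exists_element {I : Inst} {w T : ℕ} (h : Fits I.n w T)
    (hT : I.numTypes ≤ (w + 1) * T) {k i : ℕ} (hk : k < w) (hi : i < I.cnt (k + 1))
    (hc : I.cnt (k + 1) ≤ I.numTypes) (a : Fin k → ℕ) (ha : Function.Injective a)
    (han : ∀ j, a j < I.n) :
    ∃ b < I.n, I.rank b = k ∧ I.index b = i ∧ (∀ j, a j ≠ b) ∧ (∀ j, I.Beats b (a j)) ∧
      ∀ j, I.place b (a j) = j := by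
  have hlog := h.log_le
  have hpow := h.pow_le
  have hblock : I.base ^ w ≤ I.block := h.block_le
  have hcode : I.numTypes * I.base ^ (w + 1) * I.block ≤ I.n :=
    (Nat.mul_le_mul_right _ (Nat.mul_le_mul_right _ hT)).trans h.code_le
  have hn0 : I.n ≠ 0 := fun e => by rw [e] at hlog; simp at hlog
  have hw : 4 * w ^ 2 ≤ Nat.log 2 I.n := by
    rcases Nat.lt_or_ge w 2 with h | h
    · interval_cases w <;> omega
    · have e : w ^ 4 = w ^ 2 * w ^ 2 := by ring
      have : 2 ^ 2 ≤ w ^ 2 := Nat.pow_le_pow_left h 2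
      nlinarith
  have hq : 2 * ((Nat.log 2 I.n + 1) * w ^ 2) ≤ I.base := by
    unfold Inst.base; nlinarith
  have hkq : k < I.base := by
    unfold Inst.base
    nlinarith
  have hq0 : 0 < I.base := by omega
  -- Diagonal pairs stand for `a j + 1`, the others for the distances of two elements (one of the
  -- two truncated differences vanishes). These are fewer than `w ^ 2` positive numbers, each at
  -- most `n < 2 ^ (log n + 1)`.
  set N : Fin k × Fin k → ℕ := fun x =>
    if x.1 = x.2 then a x.1 + 1 else (a x.1 - a x.2) + (a x.2 - a x.1) with hN
  obtain ⟨p, hp0, hpq, hp⟩ := exists_not_dvd (Finset.univ : Finset (Fin k × Fin k)) N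
    (n := I.n) (m := (Nat.log 2 I.n + 1) * w ^ 2)
    (fun x _ => by
      simp only [hN]
      split_ifs with hx
      · omega
      · have : a x.1 ≠ a x.2 := fun e => hx (ha e)
        omega)
    (fun x _ => by
      have := han x.1
      have := han x.2
      simp only [hN]
      split_ifs <;> omega)
    (Nat.mul_pos (Nat.succ_pos _) (pow_pos (by omega) _)) (by
      have h1 : (Finset.univ : Finset (Fin k × Fin k)).card < w ^ 2 := by
        simp only [Finset.card_univ, Fintype.card_prod, Fintype.card_fin]
        nlinarith
      calc I.n ^ (Finset.univ : Finset (Fin k × Fin k)).card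
          < I.n ^ w ^ 2 := Nat.pow_lt_pow_right (by
            by_contra hlt
            have : I.n = 1 := by omega
            rw [this] at hlog
            simp at hlog) h1
        _ ≤ (2 ^ (Nat.log 2 I.n + 1)) ^ w ^ 2 :=
          Nat.pow_le_pow_left (Nat.lt_pow_succ_log_self (by norm_num) _).le _
        _ = _ := by rw [← pow_mul])
  have hpq' : p ≤ I.base := hpq.trans hq
  have hp₁ : ∀ j, ¬p ∣ a j + 1 := fun j => by simpa [hN] using hp (j, j) (Finset.mem_univ _)
  have hp₂ : ∀ j j', (a j + 1) % p = (a j' + 1) % p → j = j' := by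
    intro j j' e
    by_contra hne
    refine hp (j, j') (Finset.mem_univ _) ?_
    simp only [hN, hne, if_false]
    rcases le_total (a j) (a j') with hle | hle
    · rw [Nat.sub_eq_zero_of_le hle, zero_add]
      have := (Nat.modEq_iff_dvd' (by omega : a j + 1 ≤ a j' + 1)).1 e
      rwa [Nat.add_sub_add_right] at this
    · rw [Nat.sub_eq_zero_of_le hle, add_zero]
      have := (Nat.modEq_iff_dvd' (by omega : a j' + 1 ≤ a j + 1)).1 e.symm
      rwa [Nat.add_sub_add_right] at this
  let r : Fin k → Fin I.base := fun j =>
    ⟨(a j + 1) % p, (Nat.mod_lt _ hp0).trans_le hpq'⟩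
  let X := finFunctionFinEquiv r
  have hX : ∀ j : Fin k, dig I.base X j = (a j + 1) % p := fun j => by
    have : finFunctionFinEquiv.symm X j = r j := by rw [Equiv.symm_apply_apply]
    exact congrArg Fin.val this
  -- The digit for the modulus is `p - 1`, since `modulus` adds one to avoid the value zero.
  set v := i + I.numTypes * (k + I.base * ((p - 1) + I.base * X)) with hv
  have hTt : 0 < I.numTypes := by omega
  have hv1 : v % I.numTypes = i := by
    rw [hv, Nat.add_mul_mod_self_left, Nat.mod_eq_of_lt (by omega)]
  have hv2 : v / I.numTypes = k + I.base * ((p - 1) + I.base * X) := by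
    rw [hv, Nat.add_mul_div_left _ _ hTt, Nat.div_eq_of_lt (by omega), zero_add]
  have hv3 : v / I.numTypes % I.base = k := by
    rw [hv2, Nat.add_mul_mod_self_left, Nat.mod_eq_of_lt hkq]
  have hv4 : v / I.numTypes / I.base = (p - 1) + I.base * X := by
    rw [hv2, Nat.add_mul_div_left _ _ hq0, Nat.div_eq_of_lt hkq, zero_add]
  have hv5 : v / I.numTypes / I.base % I.base + 1 = p := by
    rw [hv4, Nat.add_mul_mod_self_left, Nat.mod_eq_of_lt (by omega)]; omega
  have hv6 : v / I.numTypes / I.base / I.base = X := by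
    rw [hv4, Nat.add_mul_div_left _ _ hq0, Nat.div_eq_of_lt (by omega), zero_add]
  have hvn : v + 1 ≤ I.numTypes * I.base ^ (w + 1) := by
    have h1 : (p - 1) + I.base * X + 1 ≤ I.base * I.base ^ k := by
      have : (X : ℕ) + 1 ≤ I.base ^ k := X.isLt
      calc (p - 1) + I.base * X + 1 ≤ I.base * (X + 1) := by rw [mul_add_one]; omega
        _ ≤ I.base * I.base ^ k := Nat.mul_le_mul_left _ this
    have h2 : k + I.base * ((p - 1) + I.base * X) + 1 ≤ I.base * (I.base * I.base ^ k) :=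
      calc k + I.base * ((p - 1) + I.base * X) + 1
          ≤ I.base * ((p - 1) + I.base * X + 1) := by rw [mul_add_one]; omega
        _ ≤ I.base * (I.base * I.base ^ k) := Nat.mul_le_mul_left _ h1
    calc v + 1 ≤ I.numTypes * (k + I.base * ((p - 1) + I.base * X) + 1) := by
          rw [hv, mul_add_one]; omega
      _ ≤ I.numTypes * (I.base * (I.base * I.base ^ k)) := Nat.mul_le_mul_left _ h2
      _ = I.numTypes * I.base ^ (k + 2) := by ring
      _ ≤ _ := Nat.mul_le_mul_left _ (Nat.pow_le_pow_right hq0 (by omega))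
  have hmod : ∀ e, 0 < I.modulus e ∧ I.modulus e ≤ I.base := fun e =>
    ⟨Nat.succ_pos _, Nat.mod_lt _ hq0⟩
  -- Fewer than `w` moduli, each at most `base`, have a product that fits into a block.
  obtain ⟨b, hb, hd, hlt⟩ := exists_div_eq_dvd_succ (E := I.block)
    (d := ∏ j, I.modulus (a j)) v (Finset.prod_pos fun j _ => (hmod _).1) (by
      calc ∏ j, I.modulus (a j) ≤ I.base ^ (Finset.univ : Finset (Fin k)).card :=
            Finset.prod_le_pow_card _ _ _ fun j _ => (hmod _).2
        _ ≤ I.base ^ w := Nat.pow_le_pow_right hq0 (by simpa using hk.le)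
        _ ≤ I.block := hblock)
  have hb : I.code b = v := hb
  have hrank : I.rank b = k := by
    unfold Inst.rank
    rw [hb, hv3, if_neg (by omega)]
  have hmb : I.modulus b = p := by unfold Inst.modulus; rw [hb, hv5]
  have hda : ∀ j, I.modulus (a j) ∣ b + 1 := fun j =>
    (Finset.dvd_prod_of_mem _ (Finset.mem_univ j)).trans hd
  -- If `a j = b`, then the modulus of `a j` is `p`, and it divides `b + 1 = a j + 1`, contrary to
  -- the choice of `p`.
  have hne : ∀ j, a j ≠ b := fun j e => hp₁ j (by rw [← hmb, e, ← e]; rw [e]; exact e ▸ hda j)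
  refine ⟨b, ?_, hrank, ?_, hne, fun j => ⟨hda j, by rw [hmb]; exact hp₁ j⟩, fun j => ?_⟩
  · exact hlt.trans_le ((Nat.mul_le_mul_right _ hvn).trans hcode)
  · unfold Inst.index
    rw [hb, hrank, hv1, Nat.mod_eq_of_lt hi]
  · unfold Inst.place
    -- The residues are distinct, so only the summand `j` survives. The cap at the rank in `place`
    -- concerns only codes that are not built in this way.
    rw [if_neg (hne j), if_neg (by have := han j; omega), hrank, hmb, Finset.sum_eq_single (j : ℕ)]
    · unfold Inst.residue
      rw [hb, hv6, hX, ind_of rfl, one_mul, min_eq_right j.isLt.le]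
    · intro j' hj' hne'
      rw [ind_of_not, zero_mul]
      unfold Inst.residue
      rw [hb, hv6]
      intro e
      have := hX ⟨j', Finset.mem_range.1 hj'⟩
      exact hne' (congrArg Fin.val (hp₂ ⟨j', Finset.mem_range.1 hj'⟩ j (this.symm.trans e)))
    · intro hj
      exact (hj (Finset.mem_range.2 j.isLt)).elim

/-! ### Encodings -/

section
variable {α β : Type*}

/-- All positions have the form "lengths of the earlier blocks plus offset". This is applied to the
tables of relations, to the types of one length, and to the lists for all lengths. -/
theorem getD_flatMap_add (d : β) (f : α → List β) (l : List α) (g : ℕ → ℕ)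
    (hg : ∀ (r : ℕ) (h : r < l.length), g r = (f l[r]).length) (i : ℕ) (hi : i < l.length) (j : ℕ)
    (hj : j < g i) :
    (l.flatMap f).getD (∑ r ∈ Finset.range i, g r + j) d = (f l[i]).getD j d := by
  induction l generalizing g i with
  | nil => simp at hi
  | cons x l ih =>
    rw [List.flatMap_cons]
    have h0 := hg 0 (by simp)
    rw [List.getElem_cons_zero] at h0
    cases i with
    | zero =>
      rw [List.getD_append _ _ _ _ (by simp; omega)]
      simp
    | succ i =>
      rw [Finset.sum_range_succ', List.getD_append_right _ _ _ _ (by omega)]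
      have := ih (fun r => g (r + 1)) (fun r h =>
        hg (r + 1) (Nat.succ_lt_succ h)) i (by simpa using hi) hj
      rw [List.getElem_cons_succ, ← this]
      congr 1
      omega

theorem length_flatMap_eq_sum (f : α → List β) (l : List α) (g : ℕ → ℕ)
    (hg : ∀ (r : ℕ) (h : r < l.length), g r = (f l[r]).length) :
    (l.flatMap f).length = ∑ r ∈ Finset.range l.length, g r := by
  induction l generalizing g with
  | nil => simp
  | cons x l ih =>
    have h0 := hg 0 (by simp)
    rw [List.getElem_cons_zero] at h0
    rw [List.flatMap_cons, List.length_append, List.length_cons, Finset.sum_range_succ', ← h0,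
      ih (fun r => g (r + 1)) (fun r h => hg (r + 1) (Nat.succ_lt_succ h)), add_comm]

theorem exists_block {f : ℕ → ℕ} {m x : ℕ} (h : x < ∑ r ∈ Finset.range m, f r) :
    ∃ R < m, ∃ t < f R, x = ∑ r ∈ Finset.range R, f r + t := by
  induction m with
  | zero => simp at h
  | succ m ih =>
    by_cases hx : x < ∑ r ∈ Finset.range m, f r
    · obtain ⟨R, hR, h⟩ := ih hx
      exact ⟨R, by omega, h⟩
    · rw [Finset.sum_range_succ] at h
      exact ⟨m, by omega, x - ∑ r ∈ Finset.range m, f r, by omega, by omega⟩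

theorem sum_range_add_lt {f : ℕ → ℕ} {R R' t : ℕ} (h : R < R') (ht : t < f R) :
    ∑ r ∈ Finset.range R, f r + t < ∑ r ∈ Finset.range R', f r :=
  calc ∑ r ∈ Finset.range R, f r + t < ∑ r ∈ Finset.range (R + 1), f r := by
        rw [Finset.sum_range_succ]; omega
    _ ≤ _ := Finset.sum_le_sum_of_subset (Finset.range_subset_range.2 h)

theorem block_unique {f : ℕ → ℕ} {R R' t t' : ℕ} (ht : t < f R) (ht' : t' < f R')
    (h : ∑ r ∈ Finset.range R, f r + t = ∑ r ∈ Finset.range R', f r + t') : R = R' ∧ t = t' := by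
  rcases lt_trichotomy R R' with hlt | rfl | hlt
  · have := sum_range_add_lt hlt ht; omega
  · exact ⟨rfl, by omega⟩
  · have := sum_range_add_lt hlt ht'; omega

end

theorem arrayOf_le {l : List ℕ} {N : ℕ} (h : ∀ x ∈ l, x ≤ N) (i : ℕ) : arrayOf l i ≤ N := by
  unfold arrayOf
  rcases Nat.lt_or_ge i l.length with hi | hi
  · rw [List.getD_eq_getElem _ _ hi]; exact h _ (List.getElem_mem hi)
  · rw [List.getD_eq_default _ _ hi]; exact Nat.zero_le _

/-! ### Positions of atoms and types in the encoded input -/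

variable {σ : Signature}

theorem Signature.arity_le_wd (R : Fin σ.numRel) : σ.arity R ≤ σ.wd :=
  Finset.le_sup (Finset.mem_univ R)

theorem Signature.exists_arity_eq_wd : ∃ R, σ.arity R = σ.wd := by
  have : Nonempty (Fin σ.numRel) := ⟨⟨0, σ.numRel_pos⟩⟩
  obtain ⟨R, -, h⟩ := Finset.exists_mem_eq_sup (Finset.univ : Finset (Fin σ.numRel))
    Finset.univ_nonempty σ.arity
  exact ⟨R, h.symm⟩

theorem Signature.wd_pos : 0 < σ.wd :=
  let ⟨R, h⟩ := σ.exists_arity_eq_wd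
  h ▸ σ.arity_pos R

/-- The arity of the relation with a given number. -/
def Signature.ar (σ : Signature) : ℕ → ℕ := arrayOf (List.ofFn σ.arity)

theorem Signature.ar_coe (R : Fin σ.numRel) : σ.ar R = σ.arity R := by
  unfold Signature.ar arrayOf
  rw [List.getD_eq_getElem _ _ (by simp)]
  simp

theorem Signature.ar_le_wd (i : ℕ) : σ.ar i ≤ σ.wd :=
  arrayOf_le (fun x hx => by
    obtain ⟨R, rfl⟩ := (List.mem_ofFn' _ _).1 hx
    exact σ.arity_le_wd R) i

/-- The position of the table of `R` in the encoding of a structure with `k` unnamed elements. -/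
def strOff (σ : Signature) (k R : ℕ) : ℕ := ∑ r ∈ Finset.range R, (k + σ.numCons) ^ σ.ar r

/-- The number of an element. -/
def eltCode {k : ℕ} (x : Fin k ⊕ Fin σ.numCons) : ℕ := finSumFinEquiv x

/-- The number of a tuple. -/
def tupleCode {k l : ℕ} (t : Fin l → Fin k ⊕ Fin σ.numCons) : ℕ :=
  finFunctionFinEquiv fun i => finSumFinEquiv (t i)

theorem eltCode_injective {k : ℕ} :
    Function.Injective (eltCode : Fin k ⊕ Fin σ.numCons → ℕ) := fun _ _ h =>
  finSumFinEquiv.injective (Fin.ext h)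

theorem eltCode_inl {k : ℕ} (x : Fin k) : eltCode (Sum.inl x : Fin k ⊕ Fin σ.numCons) = x := by
  simp [eltCode]

theorem eltCode_inr {k : ℕ} (x : Fin σ.numCons) :
    eltCode (Sum.inr x : Fin k ⊕ Fin σ.numCons) = k + x := by
  simp [eltCode]

theorem tupleCode_lt {k l : ℕ} (t : Fin l → Fin k ⊕ Fin σ.numCons) :
    tupleCode t < (k + σ.numCons) ^ l := Fin.isLt _

theorem dig_tupleCode {k l : ℕ} (t : Fin l → Fin k ⊕ Fin σ.numCons) (i : Fin l) :
    dig (k + σ.numCons) (tupleCode t) i = eltCode (t i) := by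
  have h : finFunctionFinEquiv.symm (finFunctionFinEquiv fun i => finSumFinEquiv (t i)) i =
    finSumFinEquiv (t i) := by rw [Equiv.symm_apply_apply]
  exact congrArg Fin.val h

theorem exists_tupleCode {k l u : ℕ} (hu : u < (k + σ.numCons) ^ l) :
    ∃ t : Fin l → Fin k ⊕ Fin σ.numCons, tupleCode t = u :=
  ⟨fun i => finSumFinEquiv.symm (finFunctionFinEquiv.symm ⟨u, hu⟩ i), by simp [tupleCode]⟩

theorem tupleCode_eq {k l u : ℕ} (hu : u < (k + σ.numCons) ^ l)
    {t : Fin l → Fin k ⊕ Fin σ.numCons}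
    (h : ∀ i : Fin l, dig (k + σ.numCons) u i = eltCode (t i)) : u = tupleCode t := by
  obtain ⟨t', rfl⟩ := exists_tupleCode hu
  have : t' = t := funext fun i => eltCode_injective (by rw [← h, dig_tupleCode])
  rw [this]

theorem length_encodeStr {k : ℕ} (B : σ.Str (Fin k)) :
    (encodeStr B).length = strOff σ k σ.numRel := by
  unfold encodeStr
  rw [length_flatMap_eq_sum _ _ (fun r => (k + σ.numCons) ^ σ.ar r)]
  · simp [strOff]
  · intro r h
    rw [List.length_ofFn, ← σ.ar_coe]
    simp

theorem getD_encodeStr {k : ℕ} (B : σ.Str (Fin k)) (R : Fin σ.numRel)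
    (t : Fin (σ.arity R) → Fin k ⊕ Fin σ.numCons) :
    (encodeStr B).getD (strOff σ k R + tupleCode t) 0 = (B R t).toNat := by
  unfold encodeStr strOff
  rw [getD_flatMap_add 0 _ _ (fun r => (k + σ.numCons) ^ σ.ar r) _ R (by simp) _
    (by rw [σ.ar_coe]; exact tupleCode_lt t)]
  · have hl : tupleCode t < (k + σ.numCons) ^ σ.arity R := tupleCode_lt t
    rw [List.getElem_finRange, List.getD_eq_getElem _ _ (by simpa using hl), List.getElem_ofFn]
    congr 2
    funext i
    rw [Equiv.symm_apply_eq]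
    change finFunctionFinEquiv.symm (finFunctionFinEquiv fun i => finSumFinEquiv (t i)) i = _
    rw [Equiv.symm_apply_apply]
  · intro r h
    rw [List.length_ofFn, ← σ.ar_coe]
    simp

/-- The position of the `i`-th `k`-type in the encoding of a family of sets of types. -/
def typeOff (σ : Signature) (cnt : ℕ → ℕ) (k i : ℕ) : ℕ :=
  ∑ j ∈ Finset.range k, cnt j * strOff σ j σ.numRel + i * strOff σ k σ.numRel

variable (L : ∀ k, List (σ.KType k))

theorem length_flatMap_encodeStr (k : ℕ) :
    ((L k).flatMap fun t => encodeStr t).length = (L k).length * strOff σ k σ.numRel := by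
  rw [length_flatMap_eq_sum _ _ (fun _ => strOff σ k σ.numRel)]
  · simp
  · intro r h
    rw [length_encodeStr]

theorem arrayOf_encodeCounts {k : ℕ} (hk : k ≤ σ.wd) :
    arrayOf (encodeCounts L) k = (L k).length := by
  unfold arrayOf encodeCounts
  rw [List.getD_eq_getElem _ _ (by simp; omega), List.getElem_map, List.getElem_range]

theorem arrayOf_encodeCounts_of_lt {k : ℕ} (hk : σ.wd < k) : arrayOf (encodeCounts L) k = 0 := by
  unfold arrayOf encodeCounts
  rw [List.getD_eq_default _ _ (by simp; omega)]

theorem length_encodeTypes :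
    (encodeTypes L).length =
      ∑ k ∈ Finset.range (σ.wd + 1), (L k).length * strOff σ k σ.numRel := by
  unfold encodeTypes
  rw [length_flatMap_eq_sum _ _ (fun k => (L k).length * strOff σ k σ.numRel), List.length_range]
  intro r h
  rw [length_flatMap_encodeStr, List.getElem_range]

theorem arrayOf_encodeTypes {k i x : ℕ} (hk : k ≤ σ.wd) (hi : i < (L k).length)
    (hx : x < strOff σ k σ.numRel) :
    arrayOf (encodeTypes L) (typeOff σ (arrayOf (encodeCounts L)) k i + x) =
      (encodeStr (L k)[i]).getD x 0 := by
  have e : typeOff σ (arrayOf (encodeCounts L)) k i + x =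
      ∑ j ∈ Finset.range k, (L j).length * strOff σ j σ.numRel +
        (∑ _r ∈ Finset.range i, strOff σ k σ.numRel + x) := by
    unfold typeOff
    rw [Finset.sum_congr rfl fun j hj => by
      rw [arrayOf_encodeCounts L (by have := Finset.mem_range.1 hj; omega : j ≤ σ.wd)]]
    simp [add_assoc]
  rw [e]
  unfold arrayOf encodeTypes
  rw [getD_flatMap_add 0 _ _ (fun k => (L k).length * strOff σ k σ.numRel) _ k (by simp; omega),
    List.getElem_range, getD_flatMap_add 0 _ _ (fun _ => strOff σ k σ.numRel) _ i hi _ hx]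
  · intro r h
    rw [length_encodeStr]
  · simp only [Finset.sum_const, Finset.card_range, smul_eq_mul]
    calc i * strOff σ k σ.numRel + x < (i + 1) * strOff σ k σ.numRel := by
          rw [add_mul, one_mul]; omega
      _ ≤ _ := Nat.mul_le_mul_right _ hi
  · intro r h
    rw [length_flatMap_encodeStr, List.getElem_range]

theorem toNat_mem_le {l : List ℕ} (h : l = encodeTypes L) {x : ℕ} (hx : x ∈ l) : x ≤ 1 := by
  subst h
  simp only [encodeTypes, encodeStr, List.mem_flatMap, List.mem_ofFn'] at hx
  obtain ⟨_, _, _, _, _, _, _, rfl⟩ := hx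
  exact Bool.toNat_le _

theorem strOff_eq_pow_le (k : ℕ) (R : Fin σ.numRel) :
    (k + σ.numCons) ^ σ.arity R ≤ strOff σ k σ.numRel := by
  rw [← σ.ar_coe]
  exact Finset.single_le_sum (f := fun r => (k + σ.numCons) ^ σ.ar r)
    (fun _ _ => Nat.zero_le _) (Finset.mem_range.2 R.isLt)

theorem card_kType (k : ℕ) :
    Fintype.card (σ.KType k) = ∏ R : Fin σ.numRel, 2 ^ (k + σ.numCons) ^ σ.arity R := by
  simp [Signature.KType, Signature.Str, Fintype.card_pi]

theorem card_kType_mono {k l : ℕ} (h : k ≤ l) :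
    Fintype.card (σ.KType k) ≤ Fintype.card (σ.KType l) := by
  rw [card_kType, card_kType]
  exact Finset.prod_le_prod' fun R _ => Nat.pow_le_pow_right (by norm_num)
    (Nat.pow_le_pow_left (by omega) _)

/-- A single relation of maximal arity already has `wd ^ wd` atoms over the variables. This turns
the bound on `n` into a bound for `wd` in terms of `log n`. -/
theorem two_pow_le_card_kType : 2 ^ (σ.wd ^ σ.wd) ≤ Fintype.card (σ.KType σ.wd) := by
  obtain ⟨R, hR⟩ := σ.exists_arity_eq_wd
  rw [card_kType]
  calc 2 ^ (σ.wd ^ σ.wd) ≤ 2 ^ (σ.wd + σ.numCons) ^ σ.arity R := by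
        rw [hR]
        exact Nat.pow_le_pow_right (by norm_num) (Nat.pow_le_pow_left (by omega) _)
    _ ≤ _ := Finset.single_le_prod' (f := fun R => 2 ^ (σ.wd + σ.numCons) ^ σ.arity R)
        (fun R _ => Nat.one_le_two_pow) (Finset.mem_univ R)

/-! ### The output is determined by the proposals -/

namespace Inst
variable (I : Inst)

theorem exists_of_lt_total {x : ℕ} (hx : x < I.total) :
    ∃ R < I.m, ∃ t < I.pw (I.n + I.c) R, x = I.off (I.n + I.c) R + t :=
  exists_block hx

theorem off_add_lt_total {R t : ℕ} (hR : R < I.m) (ht : t < I.pw (I.n + I.c) R) :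
    I.off (I.n + I.c) R + t < I.total :=
  sum_range_add_lt (f := I.pw (I.n + I.c)) hR ht

theorem off_add_inj {R t R' t' : ℕ} (ht : t < I.pw (I.n + I.c) R)
    (ht' : t' < I.pw (I.n + I.c) R')
    (h : I.off (I.n + I.c) R + t = I.off (I.n + I.c) R' + t') : R = R' ∧ t = t' :=
  block_unique (f := I.pw (I.n + I.c)) ht ht' h

theorem holdsAt_iff (O : ℕ → ℕ) {R t : ℕ} (hR : R < I.m) (ht : t < I.pw (I.n + I.c) R) :
    I.HoldsAt O (I.off (I.n + I.c) R + t) ↔ I.Holds O R t := by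
  refine ⟨fun ⟨R', _, t', ht', e, h⟩ => ?_, fun h => ⟨R, hR, t, ht, rfl, h⟩⟩
  obtain ⟨rfl, rfl⟩ := I.off_add_inj ht ht' e
  exact h

/-- The set of unnamed elements of the tuple `t`. -/
def support (R t : ℕ) : Set ℕ := {e | e < I.n ∧ ∃ i < I.ar R, I.elt t i = e}

theorem finite_support (R t : ℕ) : (I.support R t).Finite :=
  (Set.finite_lt_nat I.n).subset fun _ h => h.1

theorem ncard_support_le (R t : ℕ) : (I.support R t).ncard ≤ I.ar R := by
  have h : I.support R t ⊆ ((Finset.range (I.ar R)).image (I.elt t) : Finset ℕ) := by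
    rintro e ⟨_, i, hi, rfl⟩
    simp only [Finset.coe_image, Set.mem_image, Finset.mem_coe, Finset.mem_range]
    exact ⟨i, hi, rfl⟩
  calc (I.support R t).ncard ≤ ((Finset.range (I.ar R)).image (I.elt t)).card := by
        rw [← Set.ncard_coe_finset]; exact Set.ncard_le_ncard h (Finset.finite_toSet _)
    _ ≤ _ := Finset.card_image_le.trans (Finset.card_range _).le

/-- `Agrees` reads only atoms on proper subsets of the support of `t`; this makes the recursion
well-founded. -/
theorem Agrees.congr {I : Inst} {O O' : ℕ → ℕ} {b R t : ℕ}
    (h : ∀ R' < I.m, ∀ t' < I.pw (I.n + I.c) R', (I.support R' t').ncard < (I.support R t).ncard →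
      O (I.off (I.n + I.c) R' + t') = O' (I.off (I.n + I.c) R' + t'))
    (ha : I.Agrees O b R t) : I.Agrees O' b R t := by
  intro R' hR' t' ht' h₁ h₂
  rw [← h R' hR' t' ht']
  · exact ha R' hR' t' ht' h₁ h₂
  · refine Set.ncard_lt_ncard ⟨?_, ?_⟩ (I.finite_support R t)
    · rintro e ⟨he, i, hi, rfl⟩
      exact ⟨he, (h₁ i hi).resolve_left (not_le.2 he)⟩
    · obtain ⟨j, hj, hjn, hne⟩ := h₂
      intro hs
      obtain ⟨_, i, hi, e⟩ := hs ⟨hjn, j, hj, rfl⟩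
      exact hne i hi e

/-- The rank of a position is the number of unnamed elements of its atom. It is at most the arity,
hence below `n`, so `n` passes are enough. -/
theorem outAt_fixed (har : ∀ R, I.ar R < I.n) {x : ℕ} (hx : x < I.total) :
    I.outAt (I.n * I.total) x = ind (I.HoldsAt (I.outAt (I.n * I.total)) x) := by
  -- A position determines its relation and tuple, so on valid positions this is the size of the
  -- support.
  let r : ℕ → ℕ := fun x => Set.ncard {e | ∃ R < I.m, ∃ t < I.pw (I.n + I.c) R,
    x = I.off (I.n + I.c) R + t ∧ e ∈ I.support R t}
  have hr : ∀ {R t}, R < I.m → t < I.pw (I.n + I.c) R →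
      r (I.off (I.n + I.c) R + t) = (I.support R t).ncard := by
    intro R t hR ht
    refine congrArg Set.ncard (Set.ext fun e => ⟨?_, fun h => ⟨R, hR, t, ht, rfl, h⟩⟩)
    rintro ⟨R', _, t', ht', e', h⟩
    obtain ⟨rfl, rfl⟩ := I.off_add_inj ht ht' e'
    exact h
  refine cyclic_update_fixed (M := I.n) r (fun x hx => ?_) (fun O x => ind (I.HoldsAt O x))
    (fun O O' x hx h => ?_) I.outAt (fun j => rfl) le_rfl hx
  · obtain ⟨R, hR, t, ht, rfl⟩ := I.exists_of_lt_total hx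
    rw [hr hR ht]
    exact (I.ncard_support_le R t).trans_lt (har R)
  · obtain ⟨R, hR, t, ht, rfl⟩ := I.exists_of_lt_total hx
    have h' : ∀ R' < I.m, ∀ t' < I.pw (I.n + I.c) R',
        (I.support R' t').ncard < (I.support R t).ncard →
        O (I.off (I.n + I.c) R' + t') = O' (I.off (I.n + I.c) R' + t') :=
      fun R' hR' t' ht' hlt => h _ (I.off_add_lt_total hR' ht') (by rwa [hr hR' ht', hr hR ht])
    rw [propext (I.holdsAt_iff O hR ht), propext (I.holdsAt_iff O' hR ht)]
    congr 1
    exact propext ⟨fun ⟨b, hb, ho, ha, hbit⟩ => ⟨b, hb, ho, ha.congr h', hbit⟩,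
      fun ⟨b, hb, ho, ha, hbit⟩ =>
        ⟨b, hb, ho, ha.congr fun R' hR' t' ht' hlt => (h' R' hR' t' ht' hlt).symm, hbit⟩⟩

theorem outAt_eq_zero (ht : 0 < I.total) (j : ℕ) {x : ℕ} (hx : I.total ≤ x) :
    I.outAt j x = 0 := by
  induction j with
  | zero => rfl
  | succ j ih =>
    have := Nat.mod_lt j ht
    rw [outAt, Function.update_of_ne (by omega), ih]

end Inst

/-! ### From the numerical input to the proposals, and correctness of the output -/

section
variable {σ : Signature} {τ : ∀ k, Finset (σ.KType k)} {L : ∀ k, List (σ.KType k)} {n : ℕ}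

/-- The properties of the input on which the construction relies. -/
structure Valid (τ : ∀ k, Finset (σ.KType k)) (L : ∀ k, List (σ.KType k)) (n : ℕ) : Prop where
  closed : ∀ k ≤ σ.wd, ∀ t ∈ τ k, ∀ (l : ℕ) (f : Fin l → Fin k), Function.Injective f →
    Signature.Str.tp t f ∈ τ l
  consistent : ∃! t, t ∈ τ 0
  nonempty : ∀ k ≤ σ.wd, (τ k).Nonempty
  listed : ∀ k ≤ σ.wd, (L k).Nodup ∧ ∀ t, t ∈ L k ↔ t ∈ τ k
  wd_lt : σ.wd < n

namespace Valid

theorem length_pos (h : Valid τ L n) {k : ℕ} (hk : k ≤ σ.wd) : 0 < (L k).length := by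
  obtain ⟨t, ht⟩ := h.nonempty k hk
  exact List.length_pos_of_mem (((h.listed k hk).2 t).2 ht)

theorem length_zero (h : Valid τ L n) : (L 0).length = 1 := by
  obtain ⟨t, ht, hu⟩ := h.consistent
  have hl := h.listed 0 (Nat.zero_le _)
  refine le_antisymm ?_ (h.length_pos (Nat.zero_le _))
  have := List.Nodup.subperm hl.1 (l₂ := [t]) fun s hs => by
    simpa using hu s ((hl.2 s).1 hs)
  simpa using this.length_le

theorem mul_strOff_le (L : ∀ k, List (σ.KType k)) {k : ℕ} (hk : k ≤ σ.wd) :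
    (L k).length * strOff σ k σ.numRel ≤ encodingSize L := by
  refine le_trans ?_ (Nat.le_add_left _ _)
  rw [length_encodeTypes]
  exact Finset.single_le_sum (f := fun k => (L k).length * strOff σ k σ.numRel)
    (fun _ _ => Nat.zero_le _) (Finset.mem_range.2 (Nat.lt_succ_of_le hk))

/-- At least one type of maximal width is listed, so its length is a lower bound for the encoding
size. The bounds for the width and the numbers of relations and constants rest on this. -/
theorem strOff_le (h : Valid τ L n) : strOff σ σ.wd σ.numRel ≤ encodingSize L :=
  (Nat.le_mul_of_pos_left _ (h.length_pos le_rfl)).trans (mul_strOff_le L le_rfl)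

theorem pow_wd_le (h : Valid τ L n) : (σ.wd + σ.numCons) ^ σ.wd ≤ encodingSize L := by
  obtain ⟨R, hR⟩ := σ.exists_arity_eq_wd
  have := strOff_eq_pow_le σ.wd R
  rw [hR] at this
  exact this.trans h.strOff_le

theorem wd_add_le (h : Valid τ L n) : σ.wd + σ.numCons ≤ encodingSize L :=
  (Nat.le_self_pow σ.wd_pos.ne' _).trans h.pow_wd_le

theorem numRel_le (h : Valid τ L n) : σ.numRel ≤ encodingSize L := by
  refine le_trans ?_ h.strOff_le
  calc σ.numRel = ∑ _r ∈ Finset.range σ.numRel, 1 := by simp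
    _ ≤ _ := Finset.sum_le_sum fun r _ =>
      Nat.one_le_pow _ _ (by have := σ.wd_pos; omega)

theorem one_le (h : Valid τ L n) : 1 ≤ encodingSize L := by
  have := h.wd_add_le
  have := σ.wd_pos
  omega

/-- For `k > 0` every listed type takes up at least one bit. Without constants a 0-type has an empty
encoding, but there is only one of them. -/
theorem length_le (h : Valid τ L n) {k : ℕ} (hk : k ≤ σ.wd) : (L k).length ≤ encodingSize L := by
  rcases Nat.eq_zero_or_pos k with rfl | h0
  · rw [h.length_zero]; exact h.one_le
  · refine le_trans (Nat.le_mul_of_pos_right _ ?_) (mul_strOff_le L hk)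
    exact lt_of_lt_of_le (pow_pos (by omega) _) (strOff_eq_pow_le k ⟨0, σ.numRel_pos⟩)

/-- The numerical form of the input. -/
def inst (h : Valid τ L n) : Inst where
  n := n
  m := σ.numRel
  c := σ.numCons
  N := n ^ σ.wd * (n ^ σ.wd + encodingSize L) + n ^ σ.wd + encodingSize L
  ar := σ.ar
  cnt := arrayOf (encodeCounts L)
  typ := arrayOf (encodeTypes L)
  n_le := by
    have := Nat.le_self_pow σ.wd_pos.ne' n
    omega
  m_le := h.numRel_le.trans (Nat.le_add_left _ _)
  c_le := (Nat.le_add_left _ _).trans (h.wd_add_le.trans (Nat.le_add_left _ _))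
  ar_le i := (σ.ar_le_wd i).trans ((Nat.le_add_right _ _).trans
    (h.wd_add_le.trans (Nat.le_add_left _ _)))
  cnt_le i := by
    rcases Nat.lt_or_ge σ.wd i with hi | hi
    · rw [arrayOf_encodeCounts_of_lt L hi]; exact Nat.zero_le _
    · rw [arrayOf_encodeCounts L hi]
      exact (h.length_le hi).trans (Nat.le_add_left _ _)
  typ_le := arrayOf_le fun x hx => (toNat_mem_le L rfl hx).trans
    (h.one_le.trans (Nat.le_add_left _ _))
  pow_le i := by
    have hn : 2 ≤ n := by have := h.wd_lt; have := σ.wd_pos; omega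
    -- If the constants outnumber the unnamed elements, the power is bounded by the length of one
    -- listed type. The factor `2 ^ wd` lost in `n + c ≤ 2 * max n c` is absorbed by `n ^ wd`.
    have h₁ : (max n σ.numCons) ^ σ.wd ≤ n ^ σ.wd + encodingSize L := by
      rcases le_total n σ.numCons with hle | hle
      · rw [max_eq_right hle]
        exact ((Nat.pow_le_pow_left (Nat.le_add_left _ _) _).trans h.pow_wd_le).trans
          (Nat.le_add_left _ _)
      · rw [max_eq_left hle]; exact Nat.le_add_right _ _
    calc (n + σ.numCons) ^ σ.ar i ≤ (n + σ.numCons) ^ σ.wd :=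
          Nat.pow_le_pow_right (by omega) (σ.ar_le_wd i)
      _ ≤ (2 * max n σ.numCons) ^ σ.wd := Nat.pow_le_pow_left (by omega) _
      _ = 2 ^ σ.wd * max n σ.numCons ^ σ.wd := mul_pow _ _ _
      _ ≤ n ^ σ.wd * (n ^ σ.wd + encodingSize L) :=
        Nat.mul_le_mul (Nat.pow_le_pow_left hn _) h₁
      _ ≤ _ := by omega

variable (h : Valid τ L n)

theorem pw_eq {k : ℕ} (hk : k ≤ n) (R : ℕ) :
    h.inst.pw (k + σ.numCons) R = (k + σ.numCons) ^ σ.ar R :=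
  congrArg (· ^ σ.ar R) (min_eq_left (Nat.add_le_add_right hk σ.numCons))

theorem off_eq {k : ℕ} (hk : k ≤ n) (R : ℕ) : h.inst.off (k + σ.numCons) R = strOff σ k R :=
  Finset.sum_congr rfl fun r _ => h.pw_eq hk r

theorem typePos_eq {k : ℕ} (hk : k ≤ n) (i : ℕ) :
    h.inst.typePos k i = typeOff σ (arrayOf (encodeCounts L)) k i := by
  unfold Inst.typePos typeOff
  congr 1
  · refine Finset.sum_congr rfl fun j hj => ?_
    have := Finset.mem_range.1 hj
    exact congrArg _ (h.off_eq (by omega) _)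
  · exact congrArg _ (h.off_eq hk _)

/-- The fallback rank `0` is legitimate because `τ 1` is non-empty. Since the counts beyond `wd` are
read as zero, this forces every rank below `wd`, although `wd` itself is not part of the input. -/
theorem cnt_rank_ne (b : ℕ) : h.inst.cnt (h.inst.rank b + 1) ≠ 0 := by
  unfold Inst.rank
  split_ifs with hc
  · have := h.length_pos σ.wd_pos
    change arrayOf (encodeCounts L) 1 ≠ 0
    rw [arrayOf_encodeCounts L σ.wd_pos]
    exact this.ne'
  · exact hc

theorem rank_lt (b : ℕ) : h.inst.rank b < σ.wd := by
  by_contra hlt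
  exact h.cnt_rank_ne b (arrayOf_encodeCounts_of_lt L (by omega))

theorem index_lt (b : ℕ) : h.inst.index b < (L (h.inst.rank b + 1)).length := by
  rw [← arrayOf_encodeCounts L (h.rank_lt b)]
  exact Nat.mod_lt _ (Nat.pos_of_ne_zero (h.cnt_rank_ne b))

theorem place_lt (b : ℕ) (x : Fin n) : h.inst.place b x < h.inst.rank b + 1 := by
  unfold Inst.place
  split_ifs with h₁ h₂
  · omega
  · have := x.isLt
    exact absurd h₂ (not_le.2 this)
  · omega

/-- The proposals of the elements. -/
noncomputable def proposals : Proposals σ (Fin n) where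
  rank b := h.inst.rank b
  type b := (L (h.inst.rank b + 1))[h.inst.index b]'(h.index_lt b)
  place b x := ⟨h.inst.place b x, h.place_lt b x⟩
  Beats b x := h.inst.Beats b x

/-- The constant `x` has number `n + x` in the structure and `rank + 1 + x` in the proposed type;
`place` performs this renumbering, so that places are element numbers in the encoding of the type.
-/
theorem place_eltCode (b : Fin n) (z : Fin n ⊕ Fin σ.numCons) :
    h.inst.place b (eltCode z) = eltCode (Sum.map (h.proposals.place b) id z) := by
  rcases z with x | x
  · rw [Sum.map_inl, eltCode_inl, eltCode_inl]; rfl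
  · rw [Sum.map_inr, eltCode_inr, eltCode_inr]
    unfold Inst.place
    rw [if_neg (by omega), if_pos (show h.inst.n ≤ n + x from Nat.le_add_right n x)]
    change n + x - n + (h.inst.rank b + 1) = h.inst.rank b + 1 + x
    omega

theorem ar_inst (R : Fin σ.numRel) : h.inst.ar R = σ.arity R := σ.ar_coe R

theorem elt_tupleCode {l : ℕ} (t : Fin l → Fin n ⊕ Fin σ.numCons) (i : Fin l) :
    h.inst.elt (tupleCode t) i = eltCode (t i) :=
  dig_tupleCode t i

theorem tupleCode_lt_pw (R : Fin σ.numRel) (t : Fin (σ.arity R) → Fin n ⊕ Fin σ.numCons) :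
    tupleCode t < h.inst.pw (h.inst.n + h.inst.c) R := by
  refine lt_of_lt_of_eq (tupleCode_lt t) ?_
  rw [← σ.ar_coe]
  exact (h.pw_eq le_rfl R).symm

theorem exists_tupleCode_of_lt (R : Fin σ.numRel) {u : ℕ}
    (hu : u < h.inst.pw (h.inst.n + h.inst.c) R) :
    ∃ t : Fin (σ.arity R) → Fin n ⊕ Fin σ.numCons, tupleCode t = u :=
  exists_tupleCode (by
    have := h.pw_eq le_rfl (R : ℕ)
    rw [σ.ar_coe] at this
    exact lt_of_lt_of_eq hu this)

theorem bit_iff (b : Fin n) (R : Fin σ.numRel)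
    (t : Fin (σ.arity R) → Fin n ⊕ Fin σ.numCons) :
    h.inst.Bit b R (tupleCode t) ↔ h.proposals.bit b R t = true := by
  have hk : h.inst.rank b + 1 ≤ n := by
    have := h.rank_lt b
    have := h.wd_lt
    omega
  set t' : Fin (σ.arity R) → Fin (h.inst.rank b + 1) ⊕ Fin σ.numCons :=
    Sum.map (h.proposals.place b) id ∘ t with ht'
  have hdig : ∀ u, (∀ i < h.inst.ar R, dig (h.inst.rank b + 1 + h.inst.c) u i =
      h.inst.place b (h.inst.elt (tupleCode t) i)) ↔
      ∀ i : Fin (σ.arity R), dig (h.inst.rank b + 1 + σ.numCons) u i = eltCode (t' i) := by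
    intro u
    rw [h.ar_inst, Fin.forall_iff]
    refine forall₂_congr fun i hi => ?_
    have := h.elt_tupleCode t ⟨i, hi⟩
    dsimp only at this
    rw [this, h.place_eltCode]
    rfl
  have hpw : h.inst.pw (h.inst.rank b + 1 + h.inst.c) R =
      (h.inst.rank b + 1 + σ.numCons) ^ σ.arity R := by
    rw [← σ.ar_coe]; exact h.pw_eq hk R
  have htyp : h.inst.typ (h.inst.typePos (h.inst.rank b + 1) (h.inst.index b) +
      h.inst.off (h.inst.rank b + 1 + h.inst.c) R + tupleCode t') =
      (h.proposals.bit b R t).toNat := by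
    rw [h.typePos_eq hk, add_assoc]
    have e : h.inst.off (h.inst.rank b + 1 + h.inst.c) R = strOff σ (h.inst.rank b + 1) R :=
      h.off_eq hk R
    rw [e]
    refine (arrayOf_encodeTypes L (h.rank_lt b) (h.index_lt b) ?_).trans (getD_encodeStr _ R t')
    exact sum_range_add_lt (f := fun r => (h.inst.rank b + 1 + σ.numCons) ^ σ.ar r) R.isLt
      (by rw [σ.ar_coe]; exact tupleCode_lt t')
  constructor
  · rintro ⟨u, hu, hd, hne⟩
    rw [hpw] at hu
    rw [tupleCode_eq hu ((hdig u).1 hd), htyp] at hne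
    simpa using hne
  · intro hb
    refine ⟨tupleCode t', by rw [hpw]; exact tupleCode_lt t',
      (hdig _).2 fun i => dig_tupleCode t' i, ?_⟩
    rw [htyp, hb]
    decide

theorem mentions_iff (R : Fin σ.numRel) (t : Fin (σ.arity R) → Fin n ⊕ Fin σ.numCons)
    (x : Fin n) : (∃ i < h.inst.ar R, h.inst.elt (tupleCode t) i = x) ↔ Mentions t x := by
  rw [h.ar_inst]
  constructor
  · rintro ⟨i, hi, e⟩
    refine ⟨⟨i, hi⟩, eltCode_injective ?_⟩
    rw [eltCode_inl, ← e, ← h.elt_tupleCode]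
  · rintro ⟨i, e⟩
    exact ⟨i, i.isLt, by rw [h.elt_tupleCode, e, eltCode_inl]⟩

theorem forall_elt_iff (R : Fin σ.numRel) (t : Fin (σ.arity R) → Fin n ⊕ Fin σ.numCons)
    (p : ℕ → Prop) : (∀ i < h.inst.ar R, p (h.inst.elt (tupleCode t) i)) ↔
      ∀ i, p (eltCode (t i)) := by
  rw [h.ar_inst]
  exact ⟨fun H i => h.elt_tupleCode t i ▸ H i i.isLt,
    fun H i hi => (h.elt_tupleCode t ⟨i, hi⟩).symm ▸ H ⟨i, hi⟩⟩

theorem forall_lt_elt_iff (R : Fin σ.numRel) (t : Fin (σ.arity R) → Fin n ⊕ Fin σ.numCons)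
    (p : ℕ → Prop) : (∀ i < h.inst.ar R, h.inst.elt (tupleCode t) i < h.inst.n →
      p (h.inst.elt (tupleCode t) i)) ↔ ∀ x : Fin n, Mentions t x → p x := by
  rw [h.forall_elt_iff R t fun e => e < h.inst.n → p e]
  constructor
  · rintro H x ⟨i, e⟩
    have := H i
    rw [e, eltCode_inl] at this
    exact this x.isLt
  · intro H i hi
    rcases e : t i with x | x
    · rw [eltCode_inl]; exact H x ⟨i, e⟩
    · rw [e, eltCode_inr] at hi
      exact absurd hi (Nat.not_lt.2 (Nat.le_add_right n x))

/-- The numerical injectivity condition also ranges over constants. This adds nothing: their places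
lie above those of the unnamed elements and are pairwise distinct. -/
theorem owns_iff (b : Fin n) (R : Fin σ.numRel)
    (t : Fin (σ.arity R) → Fin n ⊕ Fin σ.numCons) :
    h.inst.Owns b R (tupleCode t) ↔ h.proposals.Owns b t := by
  have h₁ : (∀ i < h.inst.ar R, h.inst.n ≤ h.inst.elt (tupleCode t) i) ↔
      ∀ x, ¬Mentions t x := by
    simp only [← not_lt]
    exact h.forall_lt_elt_iff R t fun _ => False
  have h₂ := h.forall_lt_elt_iff R t fun e => e ≠ b → h.inst.Beats b e
  have h₃ : (∀ i < h.inst.ar R, ∀ j < h.inst.ar R,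
      h.inst.place b (h.inst.elt (tupleCode t) i) = h.inst.place b (h.inst.elt (tupleCode t) j) →
      h.inst.elt (tupleCode t) i = h.inst.elt (tupleCode t) j) ↔
      ∀ x y, Mentions t x → Mentions t y → h.proposals.place b x = h.proposals.place b y →
        x = y := by
    rw [h.forall_elt_iff R t fun e => ∀ j < h.inst.ar R,
      h.inst.place b e = h.inst.place b (h.inst.elt (tupleCode t) j) →
      e = h.inst.elt (tupleCode t) j]
    have : ∀ i, (∀ j < h.inst.ar R,
        h.inst.place b (eltCode (t i)) = h.inst.place b (h.inst.elt (tupleCode t) j) →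
        eltCode (t i) = h.inst.elt (tupleCode t) j) ↔ ∀ j,
        Sum.map (h.proposals.place b) id (t i) = Sum.map (h.proposals.place b) id (t j) →
        t i = t j := fun i => by
      rw [h.forall_elt_iff R t fun e => h.inst.place b (eltCode (t i)) = h.inst.place b e →
        eltCode (t i) = e]
      refine forall_congr' fun j => ?_
      rw [h.place_eltCode, h.place_eltCode, eltCode_injective.eq_iff, eltCode_injective.eq_iff]
    simp only [this]
    constructor
    · rintro H x y ⟨i, hi⟩ ⟨j, hj⟩ e
      have := H i j
      rw [hi, hj, Sum.map_inl, Sum.map_inl, e] at this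
      exact Sum.inl_injective (this rfl)
    · intro H i j e
      rcases hi : t i with x | x <;> rcases hj : t j with y | y <;> rw [hi, hj] at e
      · exact congrArg _ (H x y ⟨i, hi⟩ ⟨j, hj⟩ (Sum.inl_injective e))
      · simp at e
      · simp at e
      · exact congrArg Sum.inr (Sum.inr_injective e)
  constructor
  · rintro ⟨m, be, i⟩
    refine ⟨?_, fun x hx hne => h₂.1 be x hx fun e => hne (Fin.ext e), h₃.1 i⟩
    rwa [h.mentions_iff, h₁] at m
  · rintro ⟨m, be, i⟩
    refine ⟨?_, h₂.2 fun x hx hne => be x hx fun e => hne (congrArg Fin.val e), h₃.2 i⟩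
    rwa [h.mentions_iff, h₁]

/-- The structure that is stored in the array `O`. -/
def decode (O : ℕ → ℕ) : σ.Str (Fin n) := fun R t => decide (O (strOff σ n R + tupleCode t) ≠ 0)

theorem agrees_iff (O : ℕ → ℕ) (b : Fin n) (R : Fin σ.numRel)
    (t : Fin (σ.arity R) → Fin n ⊕ Fin σ.numCons) :
    h.inst.Agrees O b R (tupleCode t) ↔ h.proposals.Agrees (decode O) b t := by
  have h₁ : ∀ (R' : Fin σ.numRel) (t' : Fin (σ.arity R') → Fin n ⊕ Fin σ.numCons),
      (∀ i < h.inst.ar R', h.inst.n ≤ h.inst.elt (tupleCode t') i ∨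
        ∃ j < h.inst.ar R, h.inst.elt (tupleCode t) j = h.inst.elt (tupleCode t') i) ↔
      ∀ x, Mentions t' x → Mentions t x := fun R' t' => by
    simp only [← not_lt, ← imp_iff_not_or]
    rw [h.forall_lt_elt_iff R' t' fun e => ∃ j < h.inst.ar R, h.inst.elt (tupleCode t) j = e]
    simp only [h.mentions_iff]
  have h₂ : ∀ (R' : Fin σ.numRel) (t' : Fin (σ.arity R') → Fin n ⊕ Fin σ.numCons),
      (∃ j < h.inst.ar R, h.inst.elt (tupleCode t) j < h.inst.n ∧ ∀ i < h.inst.ar R',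
        h.inst.elt (tupleCode t') i ≠ h.inst.elt (tupleCode t) j) ↔
      ∃ x, Mentions t x ∧ ¬Mentions t' x := fun R' t' => by
    rw [← not_iff_not]
    push Not
    rw [h.forall_lt_elt_iff R t fun e => ∃ i < h.inst.ar R', h.inst.elt (tupleCode t') i = e]
    simp only [h.mentions_iff]
  have h₃ : ∀ (R' : Fin σ.numRel) (t' : Fin (σ.arity R') → Fin n ⊕ Fin σ.numCons),
      (O (h.inst.off (h.inst.n + h.inst.c) R' + tupleCode t') ≠ 0 ↔
        h.inst.Bit b R' (tupleCode t')) ↔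
      (decode O R' t' = true ↔ h.proposals.bit b R' t' = true) := fun R' t' => by
    rw [h.bit_iff, show h.inst.off (h.inst.n + h.inst.c) R' = strOff σ n R' from h.off_eq le_rfl R',
      decode, decide_eq_true_iff]
  constructor
  · intro H R' t' hs hm
    exact (h₃ R' t').1 (H R' R'.isLt _ (h.tupleCode_lt_pw R' t') ((h₁ R' t').2 hs)
      ((h₂ R' t').2 hm))
  · intro H R' hR' u hu hs hm
    obtain ⟨t', rfl⟩ := h.exists_tupleCode_of_lt ⟨R', hR'⟩ hu
    exact (h₃ ⟨R', hR'⟩ t').2 (H ⟨R', hR'⟩ t' ((h₁ ⟨R', hR'⟩ t').1 hs) ((h₂ ⟨R', hR'⟩ t').1 hm))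

/-- The final content of the output array. -/
noncomputable def output : ℕ → ℕ := h.inst.outAt (h.inst.n * h.inst.total)

theorem determines : h.proposals.Determines (decode h.output) := by
  intro R t
  have hlt := h.tupleCode_lt_pw R t
  have hoff : h.inst.off (h.inst.n + h.inst.c) R = strOff σ n R := h.off_eq le_rfl R
  have hfix := h.inst.outAt_fixed (fun i => (σ.ar_le_wd i).trans_lt h.wd_lt)
    (h.inst.off_add_lt_total R.isLt hlt)
  have : decode h.output R t = true ↔ h.inst.Holds h.output R (tupleCode t) := by
    rw [decode, decide_eq_true_iff, ← h.inst.holdsAt_iff h.output R.isLt hlt, ← hoff]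
    unfold output
    rw [← ind_ne_zero (p := h.inst.HoldsAt _ _), ← hfix]
  rw [this]
  constructor
  · rintro ⟨b, hb, ho, ha, hbit⟩
    exact ⟨⟨b, hb⟩, (h.owns_iff ⟨b, hb⟩ R t).1 ho, (h.agrees_iff _ ⟨b, hb⟩ R t).1 ha,
      (h.bit_iff ⟨b, hb⟩ R t).1 hbit⟩
  · rintro ⟨b, ho, ha, hbit⟩
    exact ⟨b, b.isLt, (h.owns_iff b R t).2 ho, (h.agrees_iff _ b R t).2 ha,
      (h.bit_iff b R t).2 hbit⟩

/-- The arrays must agree everywhere: the output consists of bits, and it is never written past the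
length of the encoding. -/
theorem output_eq : h.output = arrayOf (encodeStr (decode (n := n) (σ := σ) h.output)) := by
  have htot : h.inst.total = strOff σ n σ.numRel := h.off_eq le_rfl _
  have hn : 0 < n := (Nat.zero_le _).trans_lt h.wd_lt
  have hpos : 0 < h.inst.total := by
    rw [htot]
    exact lt_of_lt_of_le (pow_pos (by omega) _) (strOff_eq_pow_le n ⟨0, σ.numRel_pos⟩)
  funext x
  rcases Nat.lt_or_ge x h.inst.total with hx | hx
  · obtain ⟨R, hR, u, hu, rfl⟩ := h.inst.exists_of_lt_total hx
    obtain ⟨t, rfl⟩ := h.exists_tupleCode_of_lt ⟨R, hR⟩ hu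
    have hoff : h.inst.off (h.inst.n + h.inst.c) R = strOff σ n R := h.off_eq le_rfl R
    have := getD_encodeStr (decode (n := n) h.output) ⟨R, hR⟩ t
    rw [hoff]
    refine Eq.trans ?_ this.symm
    have hle := h.inst.outAt_le (h.inst.n * h.inst.total) (strOff σ n R + tupleCode t)
    change h.output _ ≤ 1 at hle
    unfold decode
    dsimp only
    by_cases h0 : h.output (strOff σ n R + tupleCode t) = 0
    · simp [h0]
    · simp [h0]; omega
  · rw [output, h.inst.outAt_eq_zero hpos _ hx]
    unfold arrayOf
    rw [List.getD_eq_default]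
    rw [length_encodeStr, ← htot]
    exact hx

theorem type_mem (b : Fin n) : h.proposals.type b ∈ τ (h.proposals.rank b + 1) :=
  ((h.listed _ (h.rank_lt b)).2 _).1 (List.getElem_mem _)

theorem beats_asymm (x y : Fin n) (hxy : h.proposals.Beats x y) : ¬h.proposals.Beats y x :=
  fun hyx => hyx.2 hxy.1

/-- The proposed types all induce a 0-type in `τ 0`, which has only one element. -/
theorem proposals_consistent : h.proposals.Consistent := by
  intro b b' R t ht
  obtain ⟨u, rfl⟩ := Proposals.exists_eq_map (s := (Fin.elim0 : Fin 0 → Fin n)) (t := t)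
    fun x hx => (ht x hx).elim
  have mem : ∀ b, Signature.Str.tp (h.proposals.type b) (h.proposals.place b ∘ Fin.elim0) ∈ τ 0 :=
    fun b => h.closed _ (h.rank_lt b) _ (h.type_mem b) 0 _ fun i => i.elim0
  have key : ∀ b, h.proposals.bit b R (Sum.map Fin.elim0 id ∘ u) =
      Signature.Str.tp (h.proposals.type b) (h.proposals.place b ∘ Fin.elim0) R u := fun b => by
    rw [Proposals.bit, ← Function.comp_assoc, Sum.map_comp_map]
    rfl
  rw [key, key, h.consistent.unique (mem b) (mem b')]

theorem place_self (b : Fin n) : (h.proposals.place b b : ℕ) = h.proposals.rank b :=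
  if_pos rfl

/-- The sum in `numTypes` runs up to `n`, but the counts beyond `wd < n` vanish. By monotonicity
each of the others is at most the number of types of maximal width. -/
theorem numTypes_le : h.inst.numTypes ≤ (σ.wd + 1) * Fintype.card (σ.KType σ.wd) := by
  have hw : ∀ k, k ≤ σ.wd → h.inst.cnt k ≤ Fintype.card (σ.KType σ.wd) := fun k hk => by
    change arrayOf (encodeCounts L) k ≤ _
    rw [arrayOf_encodeCounts L hk]
    exact (h.listed k hk).1.length_le_card.trans (card_kType_mono hk)
  calc h.inst.numTypes = ∑ k ∈ Finset.range (σ.wd + 1), h.inst.cnt k := by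
        symm
        refine Finset.sum_subset (Finset.range_subset_range.2 (by
          have := h.wd_lt; change σ.wd + 1 ≤ n + 1; omega)) fun k _ hk => ?_
        exact arrayOf_encodeCounts_of_lt L (by simpa using hk)
    _ ≤ ∑ _k ∈ Finset.range (σ.wd + 1), Fintype.card (σ.KType σ.wd) :=
        Finset.sum_le_sum fun k hk => hw k (by simpa [Nat.lt_succ_iff] using hk)
    _ = _ := by simp

theorem getElem_cast {k k' i i' : ℕ} (e : k' = k) (ei : i' = i) (hi : i < (L (k + 1)).length)
    (hi' : i' < (L (k' + 1)).length) (R : Fin σ.numRel)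
    (t : Fin (σ.arity R) → Fin (k + 1) ⊕ Fin σ.numCons) :
    (L (k' + 1))[i'] R (Sum.map (Fin.cast (by rw [e])) id ∘ t) = (L (k + 1))[i] R t := by
  subst e ei
  have : Sum.map (Fin.cast rfl) id ∘ t = t := funext fun j => by
    rcases h : t j <;> simp [h]
  exact congrArg _ this

theorem universal (hF : Fits n σ.wd (Fintype.card (σ.KType σ.wd))) :
    h.proposals.Universal τ := by
  intro k hk T hT a ha
  obtain ⟨i, hi, rfl⟩ := List.getElem_of_mem (((h.listed (k + 1) hk).2 T).2 hT)
  have hcnt : h.inst.cnt (k + 1) = (L (k + 1)).length := arrayOf_encodeCounts L hk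
  have hF : Fits h.inst.n σ.wd (Fintype.card (σ.KType σ.wd)) := hF
  obtain ⟨b, hb, hrank, hindex, hne, hbeats, hplace⟩ := hF.exists_element h.numTypes_le hk
    (hcnt ▸ hi) (Finset.single_le_sum (f := h.inst.cnt) (fun _ _ => Nat.zero_le _)
      (Finset.mem_range.2 (by have := h.wd_lt; change k + 1 < n + 1; omega)))
    (fun j => (a j : ℕ)) (fun x y e => ha (Fin.ext e)) (fun j => (a j).isLt)
  exact ⟨⟨b, hb⟩, fun j e => hne j (congrArg Fin.val e), hbeats, hplace, hrank,
    fun R t => getElem_cast hrank hindex hi (h.index_lt b) R t⟩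

end Valid
end

end GF

/-- There are a program and a constant `C` such that, for every normal-form sentence `φ`, every
satisfiability witness `τ` for `φ`, listed in any order without repetitions, and every
`n ≥ C * |τ^σ_{wd(σ)}| ^ (2 ^ wd(σ))`, the program halts with a model of `φ` with unnamed domain of
size `n` in its array `3`, in time polynomial in `n ^ wd(σ)` and the encoding size of `τ`. -/
theorem mainTheorem4 :
    ∃ (p : GF.Program) (C : ℕ) (P : MvPolynomial (Fin 2) ℕ), 0 < C ∧
      ∀ (σ : GF.Signature) (φ : σ.lang.Sentence) (τ : ∀ k, Finset (σ.KType k))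
        (L : ∀ k, List (σ.KType k)) (n : ℕ),
        GF.IsNormalForm φ →
        GF.IsSatWitness τ φ →
        (∀ k ≤ σ.wd, (L k).Nodup ∧ ∀ t, t ∈ L k ↔ t ∈ τ k) →
        C * Fintype.card (σ.KType σ.wd) ^ (2 ^ σ.wd) ≤ n →
        ∃ (B : σ.Str (Fin n)) (s : GF.Memory) (t : ℕ),
          GF.Exec p (GF.inputMemory σ L n) s t ∧
          s.arr 3 = GF.arrayOf (GF.encodeStr B) ∧
          B.Models φ ∧
          t ≤ MvPolynomial.eval ![n ^ σ.wd, GF.encodingSize L] P := by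
  obtain ⟨c, hc⟩ : ∃ c : ℕ, c = 2500 := ⟨_, rfl⟩
  obtain ⟨p, C, hp⟩ := GF.exists_program
  -- The polynomial is `(N + 2) ^ C` with the bound `N` from `Valid.inst`.
  refine ⟨p, 2 ^ c, (MvPolynomial.X 0 * (MvPolynomial.X 0 + MvPolynomial.X 1) +
    MvPolynomial.X 0 + MvPolynomial.X 1 + 2) ^ C, by positivity, ?_⟩
  intro σ φ τ L n _ hτ hL hn
  have hF := GF.fits hc σ.wd_pos GF.two_pow_le_card_kType hn
  -- Needed for `n` passes to suffice and for the sum over `k ≤ n` in `numTypes` to cover all lists.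
  have hwd : σ.wd < n := by
    have h₁ := hF.log_le
    have h₂ := hF.pow_le
    have h₃ : σ.wd ≤ σ.wd ^ 4 := Nat.le_self_pow (by norm_num) _
    have h₄ : Nat.log 2 n < n := Nat.log_lt_self 2 (by rintro rfl; simp at h₁)
    omega
  have h : GF.Valid τ L n := ⟨hτ.closed, hτ.consistent, hτ.nonempty, hL, hwd⟩
  have : Nonempty (Fin n) := ⟨⟨0, (Nat.zero_le _).trans_lt hwd⟩⟩
  obtain ⟨s, t, hx, ht, hs⟩ := hp h.inst (GF.inputMemory σ L n)
    ⟨rfl, rfl, rfl, rfl, rfl, rfl, rfl⟩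
  refine ⟨GF.Valid.decode h.output, s, t, hx, hs.trans h.output_eq, hτ.models _ _ ⟨Sum.inl
    (Classical.arbitrary _)⟩ ?_ ?_, ht.trans (le_of_eq ?_)⟩
  · exact h.determines.isGuardedBy hτ.closed (fun b : Fin n => h.rank_lt b) h.type_mem h.beats_asymm
      h.proposals_consistent
  · exact h.determines.hasExtensionProperty h.beats_asymm h.place_self (h.universal hF)
  · simp [GF.Valid.inst]
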